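/- Let $(\mathcal Q_m)_{m\in\mathbb N}$ be finite quantum systems: $\mathcal Q_m$ has a finite-dimensional Hilbert space $\mathcal H_m$, a self-adjoint Hamiltonian $H_m$ and a faithful state given by a density matrix $\omega_m>0$ (a matrix $\rho$ acts as the functional $\rho(A)=\mathrm{Tr}\,\rho A$). Put $\omega_{mt}=e^{-itH_m}\omega_m e^{itH_m}$ and $e_{mt}(s)=\log\mathrm{Tr}\,\omega_{mt}^{s}\omega_m^{1-s}$. **Assumption (LT).** There is an open interval $\mathbb I\supset[0,1]$ such that $e_t(s)=\lim_{m\to\infty}e_{mt}(s)$ exists and is finite for all $t>0$, $s\in\mathbb I$; the limit $e(s)=\lim_{t\to\infty}\frac1t e_t(s)$ exists and is finite for all $s\in\mathbb I$; and $e$ is differentiable on $\mathbb I$. **Error exponents.** A test is an orthogonal projection, $D(\nu,\omega)=\inf_T\big(\nu(T)+\omega(1-T)\big)$ over all tests $T$, and $\log 0=-\infty$. For nonnegative $x_{mt}$ set $$\overline\Lambda(x)=\limsup_{t\to\infty}\tfrac1{2t}\limsup_{m\to\infty}\log x_{mt},\qquad \underline\Lambda(x)=\liminf_{t\to\infty}\tfrac1{2t}\liminf_{m\to\infty}\log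 x_{mt},\qquad \Lambda(x)=\lim_{t\to\infty}\tfrac1{2t}\lim_{m\to\infty}\log x_{mt},$$ the last one when all these limits exist in $[-\infty,\infty]$. For a pair $(\nu,\omega)$ of families of states $\nu_{mt},\omega_{mt}$ of $\mathcal Q_m$ ($t>0$), the Chernoff exponents are $\underline D=\underline\Lambda(D(\nu_{mt},\omega_{mt}))$ and $\overline D=\overline\Lambda(D(\nu_{mt},\omega_{mt}))$. The Hoeffding exponents ($r\in\mathbb R$) $\underline B(r)$, $\overline B(r)$, $B(r)$ are the infima of $\underline\Lambda$, $\overline\Lambda$, $\Lambda$ of $\omega_{mt}(1-T_{mt})$ over the families of tests $(T_{mt})_{m\in\mathbb N,\,t>0}$ with $\overline\Lambda(\nu_{mt}(T_{mt}))<-r$ (for $B(r)$: those for which $\Lambda(\omega_{mt}(1-T_{mt}))$ exists). The Stein exponents ($0<\epsilon<1$) $\underline B_\epsilon$, $\overline B_\epsilon$, $B_\epsilon$ are defined in the same way with the constraint replaced by $\nu_{mt}(T_{mt})\le\epsilon$ for all $m$ and $t>0$. **Theorem.** Suppose that (LT) holds and that $0\in\,]e'(0),e'(1)[$. Then the exponents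 of the pair $(\nu,\omega)=\big((\omega_{mt}),(\omega_{m(-t)})\big)$ satisfy: 1. $\displaystyle \underline D=\overline D=\inf_{s\in[0,1]}e(s)$. 2. For all $r\in\mathbb R$, $\displaystyle \underline B(r)=\overline B(r)=B(r)=-\sup_{0\le s<1}\frac{-sr-e(s)}{1-s}$ (with value $-\infty$ if the supremum is infinite). 3. For all $\epsilon\in\,]0,1[$, $\underline B_\epsilon=\overline B_\epsilon=B_\epsilon=-\Sigma^+$. Here, with $S_m=-\log\omega_m$ and $\Sigma_m^t=\frac1t\big(e^{itH_m}S_me^{-itH_m}-S_m\big)$, the entropy production rate $\Sigma^+=\lim_{t\to\infty}\lim_{m\to\infty}\omega_m(\Sigma_m^t)$ exists and equals $e'(1)$. If the roles of the two hypotheses are exchanged, that is, for the pair $(\nu,\omega)=\big((\omega_{m(-t)}),(\omega_{mt})\big)$, then (2) holds with $e(s)$ replaced by $e(1-s)$, and (3) holds with $-\Sigma^+$ replaced by $e'(0)$. In particular, if $e(s)=e(1-s)$ for $s\in\mathbb I$, formulas (2) and (3) hold unchanged for both pairs. -/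

import Mathlib

open Filter Topology

noncomputable section

namespace ArrowOfTime

/-! ### Functionals, tests and error probabilities in finite dimension -/

/-- The real number `Tr (ρ A)`, the value `ρ(A)` of the Hermitian functional `ρ` at the
self-adjoint observable `A`. -/
def expect {d : ℕ} (ρ A : Matrix (Fin d) (Fin d) ℂ) : ℝ :=
  (Matrix.trace (ρ * A)).re

/-- Minimal total error probability `D(ν, ω) = inf_T (ν(T) + ω(1 - T))`, the infimum running over
all tests, that is, over all orthogonal projections `T`. -/
def minError {d : ℕ} (ν ω : Matrix (Fin d) (Fin d) ℂ) : ℝ :=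
  ⨅ T : {T : Matrix (Fin d) (Fin d) ℂ // IsStarProjection T},
    (expect ν T.1 + expect ω (1 - T.1))

/-- Rényi relative entropy `Ent_s(ν|ω) = log Tr (ν^s ω^(1-s))` of faithful functionals
(positive definite matrices), for real `s`. -/
def renyiEntropy {d : ℕ} (ν ω : Matrix (Fin d) (Fin d) ℂ) (s : ℝ) : ℝ :=
  Real.log (Matrix.trace
    (cfc (fun x : ℝ => x ^ s) ν * cfc (fun x : ℝ => x ^ (1 - s)) ω)).re

/-! ### Finite quantum systems -/

open scoped ComplexOrder in
/-- A finite quantum system: the Hilbert space `ℂ^dim`, a self-adjoint Hamiltonian `H`, and a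
faithful state, given by a positive definite density matrix `ω`. -/
structure FiniteQuantumSystem where
  dim : ℕ
  H : Matrix (Fin dim) (Fin dim) ℂ
  ω : Matrix (Fin dim) (Fin dim) ℂ
  isHermitian_H : H.IsHermitian
  posDef_ω : ω.PosDef
  trace_ω : ω.trace = 1

namespace FiniteQuantumSystem

/-- The unitary propagator `exp(i t H)`. -/
def propagator (Q : FiniteQuantumSystem) (t : ℝ) : Matrix (Fin Q.dim) (Fin Q.dim) ℂ :=
  NormedSpace.exp ((Complex.I * (t : ℂ)) • Q.H)

/-- The evolved state `ω_t = exp(-i t H) ω exp(i t H)`. -/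
def state (Q : FiniteQuantumSystem) (t : ℝ) : Matrix (Fin Q.dim) (Fin Q.dim) ℂ :=
  Q.propagator (-t) * Q.ω * Q.propagator t

/-- The evolved observable `A_t = exp(i t H) A exp(-i t H)`. -/
def evolve (Q : FiniteQuantumSystem) (A : Matrix (Fin Q.dim) (Fin Q.dim) ℂ) (t : ℝ) :
    Matrix (Fin Q.dim) (Fin Q.dim) ℂ :=
  Q.propagator t * A * Q.propagator (-t)

/-- The entropy observable `S = -log ω`. -/
def entropyObservable (Q : FiniteQuantumSystem) : Matrix (Fin Q.dim) (Fin Q.dim) ℂ :=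
  -cfc Real.log Q.ω

/-- The mean entropy production rate observable `Σ^t = (S_t - S) / t`. -/
def meanEntropyProduction (Q : FiniteQuantumSystem) (t : ℝ) :
    Matrix (Fin Q.dim) (Fin Q.dim) ℂ :=
  ((1 / t : ℝ) : ℂ) • (Q.evolve Q.entropyObservable t - Q.entropyObservable)

/-- The Rényi entropic functional `e_t(s) = Ent_s(ω_t|ω)`. -/
def renyi (Q : FiniteQuantumSystem) (t s : ℝ) : ℝ :=
  renyiEntropy (Q.state t) Q.ω s

end FiniteQuantumSystem

/-! ### Thermodynamic and large time limits -/

/-- Existence of the thermodynamic limit `e_t(s) = lim_m e_{mt}(s)`, for all `t > 0` and for `s` in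
an open interval `I` containing `[0, 1]`. -/
structure AssumptionTD (Q : ℕ → FiniteQuantumSystem) (I : Set ℝ) (eT : ℝ → ℝ → ℝ) : Prop where
  isOpen : IsOpen I
  ordConnected : I.OrdConnected
  subset : Set.Icc (0 : ℝ) 1 ⊆ I
  tendsto_renyi : ∀ t : ℝ, 0 < t → ∀ s ∈ I,
    Tendsto (fun m : ℕ => (Q m).renyi t s) atTop (𝓝 (eT t s))

/-- In addition, existence of the large time limit `e(s) = lim_t e_t(s) / t` for `s ∈ I`, and
differentiability of `e` on `I`. -/
structure AssumptionLT (Q : ℕ → FiniteQuantumSystem) (I : Set ℝ) (eT : ℝ → ℝ → ℝ)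
    (e : ℝ → ℝ) : Prop extends AssumptionTD Q I eT where
  tendsto_rate : ∀ s ∈ I, Tendsto (fun t : ℝ => (1 / t) * eT t s) atTop (𝓝 (e s))
  differentiable : ∀ s ∈ I, DifferentiableAt ℝ e s

/-- `σ` is the asymptotic mean entropy production rate: for each `t > 0` the limit of
`ω_m(Σ_m^t)` as `m → ∞` exists, and these limits converge to `σ` as `t → ∞`. -/
def IsEntropyProductionRate (Q : ℕ → FiniteQuantumSystem) (σ : ℝ) : Prop :=
  ∃ S : ℝ → ℝ,
    (∀ t : ℝ, 0 < t →
      Tendsto (fun m : ℕ => expect (Q m).ω ((Q m).meanEntropyProduction t)) atTop (𝓝 (S t))) ∧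
    Tendsto S atTop (𝓝 σ)

/-! ### Exponential rates: `m → ∞` first, then `t → ∞`, with weight `2t` -/

/-- Logarithm of a nonnegative real with values in `[-∞, ∞]` and `log 0 = -∞`. -/
def elog (x : ℝ) : EReal := ENNReal.log (ENNReal.ofReal x)

/-- `limsup_t (1/2t) limsup_m log x_{mt}`. -/
def upperRate (x : ℕ → ℝ → ℝ) : EReal :=
  limsup (fun t : ℝ => ((1 / (2 * t) : ℝ) : EReal) *
    limsup (fun m : ℕ => elog (x m t)) atTop) atTop

/-- `liminf_t (1/2t) liminf_m log x_{mt}`. -/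
def lowerRate (x : ℕ → ℝ → ℝ) : EReal :=
  liminf (fun t : ℝ => ((1 / (2 * t) : ℝ) : EReal) *
    liminf (fun m : ℕ => elog (x m t)) atTop) atTop

/-- The iterated limit `lim_t (1/2t) lim_m log x_{mt}` exists in `[-∞, ∞]` and equals `b`. -/
def HasRate (x : ℕ → ℝ → ℝ) (b : EReal) : Prop :=
  ∃ L : ℝ → EReal,
    (∀ t : ℝ, 0 < t → Tendsto (fun m : ℕ => elog (x m t)) atTop (𝓝 (L t))) ∧
    Tendsto (fun t : ℝ => ((1 / (2 * t) : ℝ) : EReal) * L t) atTop (𝓝 b)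

/-! ### Error exponents of a pair `(ν_{mt}, ω_{mt})` -/

/-- Families of matrices `A_{mt}` of size `d m`; only times `t > 0` matter. -/
abbrev MatrixFamily (d : ℕ → ℕ) : Type :=
  (m : ℕ) → ℝ → Matrix (Fin (d m)) (Fin (d m)) ℂ

variable {d : ℕ → ℕ}

/-- A family of tests (orthogonal projections) `T_{mt}`, `t > 0`. -/
def IsTestFamily (T : MatrixFamily d) : Prop :=
  ∀ (m : ℕ) (t : ℝ), 0 < t → IsStarProjection (T m t)

/-- Type-I error probabilities `ω_{mt}(1 - T_{mt})`. -/
def typeI (ω T : MatrixFamily d) (m : ℕ) (t : ℝ) : ℝ := expect (ω m t) (1 - T m t)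

/-- Type-II error probabilities `ν_{mt}(T_{mt})`. -/
def typeII (ν T : MatrixFamily d) (m : ℕ) (t : ℝ) : ℝ := expect (ν m t) (T m t)

/-- Lower Chernoff exponent. -/
def chernoffLower (ν ω : MatrixFamily d) : EReal :=
  lowerRate fun m t => minError (ν m t) (ω m t)

/-- Upper Chernoff exponent. -/
def chernoffUpper (ν ω : MatrixFamily d) : EReal :=
  upperRate fun m t => minError (ν m t) (ω m t)

/-- Lower Hoeffding exponent. -/
def hoeffdingLower (ν ω : MatrixFamily d) (r : ℝ) : EReal :=
  sInf {b : EReal | ∃ T : MatrixFamily d, IsTestFamily T ∧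
    upperRate (typeII ν T) < ((-r : ℝ) : EReal) ∧ b = lowerRate (typeI ω T)}

/-- Upper Hoeffding exponent. -/
def hoeffdingUpper (ν ω : MatrixFamily d) (r : ℝ) : EReal :=
  sInf {b : EReal | ∃ T : MatrixFamily d, IsTestFamily T ∧
    upperRate (typeII ν T) < ((-r : ℝ) : EReal) ∧ b = upperRate (typeI ω T)}

/-- Hoeffding exponent over the families of tests whose type-I rate exists. -/
def hoeffding (ν ω : MatrixFamily d) (r : ℝ) : EReal :=
  sInf {b : EReal | ∃ T : MatrixFamily d, IsTestFamily T ∧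
    upperRate (typeII ν T) < ((-r : ℝ) : EReal) ∧ HasRate (typeI ω T) b}

/-- Lower Stein exponent. -/
def steinLower (ν ω : MatrixFamily d) (ε : ℝ) : EReal :=
  sInf {b : EReal | ∃ T : MatrixFamily d, IsTestFamily T ∧
    (∀ (m : ℕ) (t : ℝ), 0 < t → typeII ν T m t ≤ ε) ∧ b = lowerRate (typeI ω T)}

/-- Upper Stein exponent. -/
def steinUpper (ν ω : MatrixFamily d) (ε : ℝ) : EReal :=
  sInf {b : EReal | ∃ T : MatrixFamily d, IsTestFamily T ∧
    (∀ (m : ℕ) (t : ℝ), 0 < t → typeII ν T m t ≤ ε) ∧ b = upperRate (typeI ω T)}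

/-- Stein exponent over the families of tests whose type-I rate exists. -/
def stein (ν ω : MatrixFamily d) (ε : ℝ) : EReal :=
  sInf {b : EReal | ∃ T : MatrixFamily d, IsTestFamily T ∧
    (∀ (m : ℕ) (t : ℝ), 0 < t → typeII ν T m t ≤ ε) ∧ HasRate (typeI ω T) b}

/-- `-sup_{0 ≤ s < 1} (-s r - f(s)) / (1 - s)`, in `[-∞, ∞]`. -/
def hoeffdingFunction (f : ℝ → ℝ) (r : ℝ) : EReal :=
  -(⨆ s ∈ Set.Ico (0 : ℝ) 1, (((-s * r - f s) / (1 - s) : ℝ) : EReal))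

/-! ### The two families of states to be tested against each other -/

/-- The states `ω_{mt}`. -/
def forward (Q : ℕ → FiniteQuantumSystem) : MatrixFamily fun m => (Q m).dim :=
  fun m t => (Q m).state t

/-- The states `ω_{m(-t)}`. -/
def backward (Q : ℕ → FiniteQuantumSystem) : MatrixFamily fun m => (Q m).dim :=
  fun m t => (Q m).state (-t)

end ArrowOfTime

end

/-! Everything follows from two-sided bounds on the weighted error `ν(T) + a ω(1 - T)` in terms of
Rényi entropies. Propagating both states gives `Ent_s(ω_t|ω_{-t}) = Ent_s(ω_{2t}|ω)`, so the pair
has rate function `e` with weight `1/(2t)`.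

Upper bounds come from the quantum Chernoff inequality (`exists_test_le_trace_rpow`) applied to `ν`
and `exp α • ω`: some test has both errors bounded by exponentials of `Ent_s`
(`exists_test_weighted_le`).

Lower bounds are classical. The Nussbaum-Szkoła pair (`exists_nussbaumSzkola`) bounds the weighted
error of every test from below by a sum over a probability law `w` of a log-likelihood `y`, with
`exp Ent_s = ∑ w exp((s - 1) y)` (`exists_modular_law`). By the Gärtner-Ellis argument,
differentiability of the rate function `f` at `s` makes the law tilted by `s` concentrate at `y ≈ 2t
f'(s)`. Hence no test beats the tangent line of `f` at `s`: its value at `1` governs the type-II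
exponent and its value at `0` the type-I exponent (`eventually_le_error`, `tangent_le_lowerRate`).
The Chernoff exponent uses the horizontal tangent, the Hoeffding exponent a supporting line equal to
`-r` at `1`, and the Stein exponent the tangent at `1`.

The exponents `B(r)` and `B_ε` need tests whose type-I errors converge as `m → ∞`. Since `e` is
negative somewhere, states at well separated times are almost orthogonal, so dimensions tend to
infinity (`tendsto_dim_atTop`). In large dimension a test can be deformed until its type-I error
nearly equals a prescribed value (`exists_test_approx`).

Finally `ω(Σ^t)` is the mean of `y / t`. Moment generating functions near `0` control its limit in
`m`, and Jensen's inequality squeezes its limit in `t` to `e'(1)`. -/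

namespace ArrowOfTime

open scoped ComplexOrder MatrixOrder

/-! ### The quantum Chernoff bound and the Nussbaum-Szkoła lower bound. -/

section

variable {d : ℕ}

section LoewnerHeinz
open scoped Matrix.Norms.L2Operator

theorem cfc_rpow_le_cfc_rpow {A B : Matrix (Fin d) (Fin d) ℂ} (hA : A.PosSemidef)
    (hAB : (B - A).PosSemidef) {s : ℝ} (hs : s ∈ Set.Icc (0 : ℝ) 1) :
    (cfc (fun x : ℝ => x ^ s) B - cfc (fun x : ℝ => x ^ s) A).PosSemidef := by
  have h1 : (0 : Matrix (Fin d) (Fin d) ℂ) ≤ A := Matrix.nonneg_iff_posSemidef.2 hA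
  have h2 : A ≤ B := Matrix.le_iff.2 hAB
  have := CFC.rpow_le_rpow hs h2
  rw [CFC.rpow_eq_cfc_real h1, CFC.rpow_eq_cfc_real (h1.trans h2)] at this
  exact Matrix.le_iff.1 this

end LoewnerHeinz

theorem exists_unitary_cfc_eq {A : Matrix (Fin d) (Fin d) ℂ} (hA : A.IsHermitian) :
    ∃ (U : Matrix (Fin d) (Fin d) ℂ) (l : Fin d → ℝ), U * star U = 1 ∧ star U * U = 1 ∧
      (∀ i, l i ∈ spectrum ℝ A) ∧
      ∀ f : ℝ → ℝ, cfc f A = U * Matrix.diagonal (fun i => (f (l i) : ℂ)) * star U := by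
  refine ⟨hA.eigenvectorUnitary, hA.eigenvalues, Unitary.coe_mul_star_self _,
    Unitary.coe_star_mul_self _, hA.eigenvalues_mem_spectrum_real, fun f => ?_⟩
  rw [hA.cfc_eq, Matrix.IsHermitian.cfc, Unitary.conjStarAlgAut_apply]
  rfl

theorem continuousOn_spectrum (A : Matrix (Fin d) (Fin d) ℂ) (f : ℝ → ℝ) :
    ContinuousOn f (spectrum ℝ A) :=
  Matrix.finite_real_spectrum.continuousOn f

theorem cfc_mul_cfc (A : Matrix (Fin d) (Fin d) ℂ) (f g : ℝ → ℝ) :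
    cfc f A * cfc g A = cfc (fun x => f x * g x) A :=
  (cfc_mul f g A (continuousOn_spectrum A f) (continuousOn_spectrum A g)).symm

theorem posSemidef_cfc {A : Matrix (Fin d) (Fin d) ℂ} (f : ℝ → ℝ)
    (hf : ∀ x ∈ spectrum ℝ A, 0 ≤ f x) : (cfc f A).PosSemidef :=
  Matrix.nonneg_iff_posSemidef.1 (cfc_nonneg hf)

theorem spectrum_nonneg {A : Matrix (Fin d) (Fin d) ℂ} (hA : A.PosSemidef) :
    ∀ x ∈ spectrum ℝ A, 0 ≤ x := by
  intro x hx
  rw [hA.1.spectrum_real_eq_range_eigenvalues] at hx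
  obtain ⟨i, rfl⟩ := hx
  exact hA.eigenvalues_nonneg i

theorem posSemidef_cfc_rpow {A : Matrix (Fin d) (Fin d) ℂ} (hA : A.PosSemidef) (s : ℝ) :
    (cfc (fun x : ℝ => x ^ s) A).PosSemidef :=
  posSemidef_cfc _ fun x hx => Real.rpow_nonneg (spectrum_nonneg hA x hx) s

theorem re_trace_mul_nonneg {A B : Matrix (Fin d) (Fin d) ℂ} (hA : A.PosSemidef)
    (hB : B.PosSemidef) : 0 ≤ (Matrix.trace (A * B)).re := by
  obtain ⟨C, rfl⟩ := CStarAlgebra.nonneg_iff_eq_star_mul_self.1 (Matrix.nonneg_iff_posSemidef.2 hA)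
  rw [Matrix.mul_assoc, Matrix.trace_mul_comm]
  have := (hB.mul_mul_conjTranspose_same C).trace_nonneg
  exact (Complex.le_def.1 this).1

theorem cfc_rpow_mul_cfc_rpow_one_sub {A : Matrix (Fin d) (Fin d) ℂ} (hA : A.PosSemidef)
    (s : ℝ) : cfc (fun x : ℝ => x ^ s) A * cfc (fun x : ℝ => x ^ (1 - s)) A = A := by
  rw [cfc_mul_cfc]
  conv_rhs => rw [← cfc_id ℝ A hA.1.isSelfAdjoint]
  refine cfc_congr fun x hx => ?_
  have hx0 := spectrum_nonneg hA x hx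
  -- At a zero eigenvalue the convention `0 ^ 0 = 1` is harmless, since the other factor is then `0
  -- ^ 1`.
  rcases hx0.eq_or_lt with h | h
  · subst h
    by_cases h : s = 0
    · simp [h]
    · simp [Real.zero_rpow h]
  · simp only [id]
    rw [← Real.rpow_add h]
    simp

theorem isStarProjection_cfc (A : Matrix (Fin d) (Fin d) ℂ) (f : ℝ → ℝ)
    (hf : ∀ x, f x * f x = f x) : IsStarProjection (cfc f A) := by
  refine ⟨?_, cfc_predicate f A⟩
  rw [IsIdempotentElem, cfc_mul_cfc]
  simp only [hf]

/-- The quantum Chernoff bound. -/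
theorem exists_test_le_trace_rpow {ν ω : Matrix (Fin d) (Fin d) ℂ} (hν : ν.PosSemidef)
    (hω : ω.PosSemidef) {s : ℝ} (hs : s ∈ Set.Icc (0 : ℝ) 1) :
    ∃ T, IsStarProjection T ∧ expect ν T + expect ω (1 - T) ≤
      (Matrix.trace (cfc (fun x : ℝ => x ^ s) ν * cfc (fun x : ℝ => x ^ (1 - s)) ω)).re := by
  have hs' : 1 - s ∈ Set.Icc (0 : ℝ) 1 := ⟨by linarith [hs.2], by linarith [hs.1]⟩
  have hD : (ω - ν).IsHermitian := hω.1.sub hν.1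
  set T := cfc (fun x : ℝ => if 0 < x then 1 else 0) (ω - ν) with hT
  refine ⟨T, isStarProjection_cfc _ _ fun x => by split_ifs <;> simp, ?_⟩
  have hΔ : (ω - ν) * T = cfc (fun x : ℝ => max x 0) (ω - ν) := by
    conv_lhs => enter [1]; rw [← cfc_id ℝ (ω - ν) hD.isSelfAdjoint]
    rw [hT, cfc_mul_cfc]
    congr 1
    funext x
    split_ifs with h
    · simp [h.le]
    · simp [not_lt.1 h]
  have hΔ1 : ((ω - ν) * T).PosSemidef := by
    rw [hΔ]
    exact posSemidef_cfc _ fun x _ => le_max_right _ _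
  have hΔ2 : ((ω - ν) * T - (ω - ν)).PosSemidef := by
    have : (ω - ν) * T - (ω - ν) = cfc (fun x : ℝ => max x 0 - x) (ω - ν) := by
      rw [cfc_sub _ _ _ (continuousOn_spectrum _ _) (continuousOn_spectrum _ _), hΔ, cfc_id' ℝ _ hD.isSelfAdjoint]
    rw [this]
    exact posSemidef_cfc _ fun x _ => sub_nonneg.2 (le_max_left _ _)
  set Δ := (ω - ν) * T with hΔdef
  -- Here `Δ` is the positive part of `ω - ν`, so `C = ν + Δ` dominates both states. Operator
  -- monotonicity of powers makes the three traces `i1`, `i2`, `i3` nonnegative; in their sum the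
  -- mixed terms `C^s ω^(1-s)` and `ν^s C^(1-s)` cancel, leaving `Tr ω - Tr Δ ≤ Tr ν^s ω^(1-s)`.
  have hC : (ν + Δ).PosSemidef := hν.add hΔ1
  have hCω : (ν + Δ - ω).PosSemidef := by
    convert hΔ2 using 1; abel
  have hCν : (ν + Δ - ν).PosSemidef := by
    convert hΔ1 using 1; abel
  have i1 := re_trace_mul_nonneg (cfc_rpow_le_cfc_rpow hω hCω hs) (posSemidef_cfc_rpow hω (1 - s))
  have i2 := re_trace_mul_nonneg (cfc_rpow_le_cfc_rpow hν hCν hs) (cfc_rpow_le_cfc_rpow hω hCω hs')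
  have i3 := re_trace_mul_nonneg (posSemidef_cfc_rpow hν s) (cfc_rpow_le_cfc_rpow hν hCν hs')
  simp only [Matrix.sub_mul, Matrix.mul_sub, Matrix.trace_sub, Complex.sub_re,
    cfc_rpow_mul_cfc_rpow_one_sub hν, cfc_rpow_mul_cfc_rpow_one_sub hω,
    cfc_rpow_mul_cfc_rpow_one_sub hC] at i1 i2 i3
  have e1 : expect ν T + expect ω (1 - T) = (Matrix.trace ω).re - (Matrix.trace Δ).re := by
    simp only [expect, hΔdef, Matrix.mul_sub, Matrix.sub_mul, Matrix.trace_sub, Complex.sub_re,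
      Matrix.mul_one]
    ring
  rw [Matrix.trace_add, Complex.add_re] at i2
  rw [e1]
  linarith

theorem expect_nonneg {ρ T : Matrix (Fin d) (Fin d) ℂ} (hρ : ρ.PosSemidef)
    (hT : IsStarProjection T) : 0 ≤ expect ρ T :=
  re_trace_mul_nonneg hρ (Matrix.nonneg_iff_posSemidef.1 hT.nonneg)

theorem spectrum_pos {A : Matrix (Fin d) (Fin d) ℂ} (hA : A.PosDef) :
    ∀ x ∈ spectrum ℝ A, 0 < x := by
  intro x hx
  rw [hA.1.spectrum_real_eq_range_eigenvalues] at hx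
  obtain ⟨i, rfl⟩ := hx
  exact hA.eigenvalues_pos i

theorem re_trace_diagonal_mul_mul_star (f : Fin d → ℝ) (K : Matrix (Fin d) (Fin d) ℂ) :
    (Matrix.trace (Matrix.diagonal (fun i => (f i : ℂ)) * (K * star K))).re =
      ∑ i, f i * ∑ j, Complex.normSq (K i j) := by
  simp only [Matrix.trace, Matrix.diag_apply, Matrix.diagonal_mul, Complex.re_sum]
  refine Finset.sum_congr rfl fun i _ => ?_
  rw [Complex.re_ofReal_mul, Matrix.mul_apply, Complex.re_sum]
  congr 1
  refine Finset.sum_congr rfl fun j _ => ?_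
  simp [Matrix.star_apply, Complex.mul_conj]

/-- Write `X = X Y Y* X`. The free choice of `Y` allows `ν(T)` and `ω(1 - T)` to be expanded over
the same pairs of eigenvectors of `ν` and `ω`. -/
theorem expect_eq_sum_normSq {ρ U X Y : Matrix (Fin d) (Fin d) ℂ} {l : Fin d → ℝ}
    (hρ : ρ = U * Matrix.diagonal (fun i => (l i : ℂ)) * star U) (hX : IsStarProjection X)
    (hY : Y * star Y = 1) :
    expect ρ X = ∑ i, l i * ∑ j, Complex.normSq ((star U * X * Y) i j) := by
  have hs : star X = X := hX.isSelfAdjoint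
  rw [← re_trace_diagonal_mul_mul_star, expect, hρ, star_mul, star_mul, star_star, Matrix.mul_assoc,
    Matrix.mul_assoc, Matrix.trace_mul_comm, hs]
  congr 2
  simp only [Matrix.mul_assoc]
  rw [← Matrix.mul_assoc Y, hY, Matrix.one_mul, ← Matrix.mul_assoc X X, hX.isIdempotentElem.eq]

/-- The Nussbaum-Szkoła pair of classical distributions of two quantum states. -/
theorem exists_nussbaumSzkola {ν ω : Matrix (Fin d) (Fin d) ℂ} (hν : ν.PosDef) (hω : ω.PosDef) :
    ∃ p l μ : Fin d × Fin d → ℝ, (∀ k, 0 ≤ p k) ∧ (∀ k, 0 < l k) ∧ (∀ k, 0 < μ k) ∧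
      (∀ f g : ℝ → ℝ, (Matrix.trace (cfc f ν * cfc g ω)).re = ∑ k, p k * (f (l k) * g (μ k))) ∧
      ∀ T, IsStarProjection T → ∀ a : ℝ, 0 < a →
        ∑ k, p k * (l k * (a * μ k) / (l k + a * μ k)) ≤
          expect ν T + a * expect ω (1 - T) := by
  obtain ⟨U, l, hUU, -, hl, hU⟩ := exists_unitary_cfc_eq hν.1
  obtain ⟨V, μ, hVV, -, hμ, hV⟩ := exists_unitary_cfc_eq hω.1
  replace hl : ∀ i, 0 < l i := fun i => spectrum_pos hν _ (hl i)
  replace hμ : ∀ i, 0 < μ i := fun i => spectrum_pos hω _ (hμ i)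
  refine ⟨fun k => Complex.normSq ((star U * V) k.1 k.2), fun k => l k.1,
    fun k => μ k.2, fun k => Complex.normSq_nonneg _,
    fun k => hl _, fun k => hμ _, ?_, ?_⟩
  · intro f g
    rw [hU f, hV g]
    have : Matrix.trace (U * Matrix.diagonal (fun i => (f (l i) : ℂ)) * star U *
        (V * Matrix.diagonal (fun i => (g (μ i) : ℂ)) * star V)) =
        Matrix.trace (Matrix.diagonal (fun i => (f (l i) : ℂ)) *
          ((star U * V) * Matrix.diagonal (fun i => (g (μ i) : ℂ)) *
            star (star U * V))) := by
      rw [star_mul, star_star, Matrix.mul_assoc, Matrix.mul_assoc, Matrix.trace_mul_comm]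
      simp only [Matrix.mul_assoc]
    rw [this]
    simp only [Matrix.trace, Matrix.diag_apply, Matrix.diagonal_mul, Complex.re_sum,
      Fintype.sum_prod_type]
    refine Finset.sum_congr rfl fun i _ => ?_
    rw [Complex.re_ofReal_mul, Matrix.mul_apply, Complex.re_sum, Finset.mul_sum]
    refine Finset.sum_congr rfl fun j _ => ?_
    rw [Matrix.mul_diagonal, Matrix.star_apply, mul_right_comm, Complex.star_def,
      Complex.mul_conj, ← Complex.ofReal_mul, Complex.ofReal_re]
    ring
  · intro T hT a ha
    have hTs' : star (1 - T) = 1 - T := hT.one_sub.isSelfAdjoint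
    have eν := hU id
    have eω := hV id
    rw [cfc_id ℝ ν hν.1.isSelfAdjoint] at eν
    rw [cfc_id ℝ ω hω.1.isSelfAdjoint] at eω
    rw [expect_eq_sum_normSq eν hT hVV, expect_eq_sum_normSq eω hT.one_sub hUU,
      Fintype.sum_prod_type, Finset.mul_sum]
    have h2 : ∑ j, a * (id (μ j) * ∑ i, Complex.normSq ((star V * (1 - T) * U) j i)) =
        ∑ i, ∑ j, a * μ j * Complex.normSq ((star U * (1 - T) * V) i j) := by
      rw [Finset.sum_comm]
      refine Finset.sum_congr rfl fun j _ => ?_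
      rw [Finset.mul_sum, Finset.mul_sum]
      refine Finset.sum_congr rfl fun i _ => ?_
      have : (star U * (1 - T) * V) i j = star ((star V * (1 - T) * U) j i) := by
        rw [← Matrix.star_apply, star_mul, star_mul, star_star, hTs', Matrix.mul_assoc]
      rw [this, Complex.star_def, Complex.normSq_conj, id]
      ring
    rw [h2, ← Finset.sum_add_distrib]
    refine Finset.sum_le_sum fun i _ => ?_
    rw [Finset.mul_sum, ← Finset.sum_add_distrib]
    refine Finset.sum_le_sum fun j _ => ?_
    -- The overlap amplitude splits as `z + w` along `T` and `1 - T`, and Cauchy-Schwarz gives `|z +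
    -- w|² x y / (x + y) ≤ x |z|² + y |w|²`.
    have hz : (star U * V) i j = (star U * T * V) i j + (star U * (1 - T) * V) i j := by
      rw [← Matrix.add_apply, ← Matrix.add_mul, ← Matrix.mul_add, add_sub_cancel, Matrix.mul_one]
    dsimp only [id]
    rw [hz]
    have hl' := hl i
    have hm := mul_pos ha (hμ j)
    generalize l i = x at *
    generalize a * μ j = y at *
    generalize (star U * T * V) i j = z
    generalize (star U * (1 - T) * V) i j = w
    rw [mul_div_assoc', div_le_iff₀ (by positivity)]
    simp only [Complex.normSq_apply, Complex.add_re, Complex.add_im]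
    nlinarith [sq_nonneg (x * z.re - y * w.re), sq_nonneg (x * z.im - y * w.im)]

end

/-! ### Adjusting the type-I error of a test in large dimension. -/

section

variable {d : ℕ}

theorem re_trace_mul_diagonal_indicator (N : Matrix (Fin d) (Fin d) ℂ) (s : Finset (Fin d)) :
    (Matrix.trace (N * Matrix.diagonal fun k => if k ∈ s then (1 : ℂ) else 0)).re =
      ∑ k ∈ s, (N k k).re := by
  simp only [Matrix.trace, Matrix.diag_apply, Matrix.mul_diagonal, Complex.re_sum, mul_ite,
    mul_one, mul_zero]
  rw [← Finset.sum_filter_add_sum_filter_not Finset.univ (fun k => k ∈ s),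
    Finset.sum_congr rfl (g := fun k => (N k k).re),
    Finset.sum_eq_zero (s := Finset.univ.filter (fun k => ¬ k ∈ s))]
  · simp
  · intro k hk; simp [(Finset.mem_filter.1 hk).2]
  · intro k hk; simp [(Finset.mem_filter.1 hk).2]

/-- The test projects onto the span of the columns of `U` indexed by `s` and the real unit
combination `c e_i + σ e_j` of two further columns. As `(c, σ)` turns, it exchanges one column for
another continuously. -/
theorem exists_test_rotation {U : Matrix (Fin d) (Fin d) ℂ} (hU : star U * U = 1)
    (s : Finset (Fin d)) {i j : Fin d} (hij : i ≠ j) (hi : i ∉ s) (hj : j ∉ s) (c σ : ℝ)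
    (hcσ : c ^ 2 + σ ^ 2 = 1) :
    ∃ T, IsStarProjection T ∧ ∀ ρ : Matrix (Fin d) (Fin d) ℂ,
      expect ρ T = ∑ k ∈ s, ((star U * ρ * U) k k).re + c ^ 2 * ((star U * ρ * U) i i).re +
        σ ^ 2 * ((star U * ρ * U) j j).re +
        c * σ * ((star U * ρ * U) i j + (star U * ρ * U) j i).re := by
  set z : Fin d → ℂ := Pi.single i (c : ℂ) + Pi.single j (σ : ℂ) with hz
  have hzs : star z = z := by
    rw [hz, star_add, ← Pi.single_star, ← Pi.single_star]
    simp
  set D : Matrix (Fin d) (Fin d) ℂ := Matrix.diagonal fun k => if k ∈ s then 1 else 0 with hD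
  have hDz : D.mulVec z = 0 := by
    funext k
    rw [hD, Matrix.mulVec_diagonal, hz]
    simp only [Pi.add_apply, Pi.zero_apply]
    split_ifs with hk
    · rw [Pi.single_eq_of_ne (by rintro rfl; exact hi hk),
        Pi.single_eq_of_ne (by rintro rfl; exact hj hk)]
      simp
    · simp
  have hDD : D * D = D := by
    rw [hD, Matrix.diagonal_mul_diagonal]
    congr 1; funext k; split_ifs <;> simp
  have hDs : star D = D := by
    rw [hD, Matrix.star_eq_conjTranspose, Matrix.diagonal_conjTranspose]
    congr 1; funext k; simp only [Pi.star_apply]; split_ifs <;> simp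
  have hzz : z ⬝ᵥ z = 1 := by
    rw [hz]
    simp only [add_dotProduct, dotProduct_add, single_dotProduct, Pi.single_eq_same,
      Pi.single_eq_of_ne hij, Pi.single_eq_of_ne hij.symm]
    have : ((c ^ 2 + σ ^ 2 : ℝ) : ℂ) = 1 := by rw [hcσ]; simp
    push_cast at this
    linear_combination this
  set M := D + Matrix.vecMulVec z z with hM
  have hMs : star M = M := by
    rw [hM, star_add, hDs, Matrix.star_eq_conjTranspose, Matrix.conjTranspose_vecMulVec, hzs]
  have hMM : M * M = M := by
    have h1 : D * Matrix.vecMulVec z z = 0 := by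
      rw [Matrix.mul_vecMulVec, hDz]; ext; simp [Matrix.vecMulVec_apply]
    have h2 : Matrix.vecMulVec z z * D = 0 := by
      have := congrArg star h1
      rwa [star_mul, hDs, star_zero, Matrix.star_eq_conjTranspose (Matrix.vecMulVec z z),
        Matrix.conjTranspose_vecMulVec, hzs] at this
    rw [hM, Matrix.add_mul, Matrix.mul_add, Matrix.mul_add, h1, h2, hDD,
      Matrix.vecMulVec_mul_vecMulVec, hzz]
    simp
  refine ⟨U * M * star U, ⟨?_, ?_⟩, fun ρ => ?_⟩
  · rw [IsIdempotentElem]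
    calc U * M * star U * (U * M * star U) = U * (M * (star U * U) * M) * star U := by
          simp only [Matrix.mul_assoc]
      _ = _ := by rw [hU, Matrix.mul_one, hMM]
  · rw [IsSelfAdjoint, star_mul, star_mul, star_star, hMs, Matrix.mul_assoc]
  · have : Matrix.trace (ρ * (U * M * star U)) = Matrix.trace ((star U * ρ * U) * M) := by
      rw [← Matrix.mul_assoc, ← Matrix.mul_assoc, Matrix.trace_mul_comm]
      simp only [Matrix.mul_assoc]
    rw [expect, this]
    generalize star U * ρ * U = N
    rw [hM, Matrix.mul_add, Matrix.trace_add, Complex.add_re, Matrix.mul_vecMulVec,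
      Matrix.trace_vecMulVec, hD]
    rw [re_trace_mul_diagonal_indicator, hz]
    simp only [Matrix.mulVec_add, Matrix.mulVec_single, dotProduct_add, dotProduct_single,
      Complex.add_re]
    simp [-Complex.ofReal_mul]
    ring

theorem expect_mul_diagonal_mul_star (U ρ : Matrix (Fin d) (Fin d) ℂ) (s : Finset (Fin d)) :
    expect ρ (U * (Matrix.diagonal fun k => if k ∈ s then (1 : ℂ) else 0) * star U) =
      ∑ k ∈ s, ((star U * ρ * U) k k).re := by
  rw [← re_trace_mul_diagonal_indicator, expect, ← Matrix.mul_assoc, ← Matrix.mul_assoc,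
    Matrix.trace_mul_comm]
  simp only [Matrix.mul_assoc]

theorem exists_test_finset {U : Matrix (Fin d) (Fin d) ℂ} (hU : star U * U = 1)
    (s : Finset (Fin d)) :
    ∃ T, IsStarProjection T ∧ ∀ ρ : Matrix (Fin d) (Fin d) ℂ,
      expect ρ T = ∑ k ∈ s, ((star U * ρ * U) k k).re := by
  set D : Matrix (Fin d) (Fin d) ℂ := Matrix.diagonal fun k => if k ∈ s then 1 else 0 with hD
  have hDD : D * D = D := by
    rw [hD, Matrix.diagonal_mul_diagonal]
    congr 1; funext k; split_ifs <;> simp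
  have hDs : star D = D := by
    rw [hD, Matrix.star_eq_conjTranspose, Matrix.diagonal_conjTranspose]
    congr 1; funext k; simp only [Pi.star_apply]; split_ifs <;> simp
  refine ⟨U * D * star U, ⟨?_, ?_⟩, fun ρ => expect_mul_diagonal_mul_star U ρ s⟩
  · rw [IsIdempotentElem]
    calc U * D * star U * (U * D * star U) = U * (D * (star U * U) * D) * star U := by
          simp only [Matrix.mul_assoc]
      _ = _ := by rw [hU, Matrix.mul_one, hDD]
  · rw [IsSelfAdjoint, star_mul, star_mul, star_star, hDs, Matrix.mul_assoc]

theorem exists_finset_of_isStarProjection {T : Matrix (Fin d) (Fin d) ℂ} (hT : IsStarProjection T) :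
    ∃ (U : Matrix (Fin d) (Fin d) ℂ) (s : Finset (Fin d)), U * star U = 1 ∧ star U * U = 1 ∧
      T = U * (Matrix.diagonal fun k => if k ∈ s then (1 : ℂ) else 0) * star U := by
  classical
  obtain ⟨U, τ, hU1, hU2, -, hU⟩ := exists_unitary_cfc_eq hT.isSelfAdjoint
  have e := hU id
  rw [cfc_id ℝ T hT.isSelfAdjoint] at e
  have hτ : ∀ i, τ i = 0 ∨ τ i = 1 := by
    have h := hT.isIdempotentElem.eq
    have hd : star U * T * U = Matrix.diagonal (fun i => ((id (τ i) : ℝ) : ℂ)) := by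
      rw [e]
      calc _ = (star U * U) * Matrix.diagonal (fun i => ((id (τ i) : ℝ) : ℂ)) * (star U * U) := by
            simp only [Matrix.mul_assoc]
        _ = _ := by rw [hU2, Matrix.one_mul, Matrix.mul_one]
    have h2 : (star U * T * U) * (star U * T * U) = star U * T * U := by
      calc _ = star U * (T * (U * star U) * T) * U := by simp only [Matrix.mul_assoc]
        _ = _ := by rw [hU1, Matrix.mul_one, h]
    rw [hd, Matrix.diagonal_mul_diagonal] at h2
    intro i
    have := congrFun (Matrix.diagonal_injective h2) i
    simp only [id] at this
    norm_cast at this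
    have : τ i * (τ i - 1) = 0 := by linarith
    rcases mul_eq_zero.1 this with h | h
    · exact Or.inl h
    · exact Or.inr (by linarith)
  refine ⟨U, Finset.univ.filter (fun i => τ i = 1), hU1, hU2, ?_⟩
  conv_lhs => rw [e]
  congr 3
  funext i
  rcases hτ i with h | h <;> simp [h]

/-- In large dimension every type-I error probability above that of a given test is nearly attained
by a test whose type-II error probability is comparable. -/
theorem exists_test_approx {ν ω T₀ : Matrix (Fin d) (Fin d) ℂ} (hν : ν.PosSemidef)
    (hω : ω.PosSemidef) (hν1 : ν.trace = 1) (hω1 : ω.trace = 1) (hT₀ : IsStarProjection T₀)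
    {x : ℝ} (hx : x ≤ 1) (hT₀x : expect ω (1 - T₀) ≤ x) {n : ℕ} (hn : 0 < n) (hd : 2 * n ≤ d) :
    ∃ T, IsStarProjection T ∧ |expect ω (1 - T) - x| ≤ 2 / n ∧
      expect ν T ≤ 2 * expect ν T₀ + 4 / n := by
  classical
  have hone : ∀ T, expect ω (1 - T) = 1 - expect ω T := fun T => by
    simp only [expect, Matrix.mul_sub, Matrix.mul_one, Matrix.trace_sub, hω1]
    simp
  obtain ⟨U, s₀, hU1, hU2, rfl⟩ := exists_finset_of_isStarProjection hT₀
  rw [hone, expect_mul_diagonal_mul_star] at hT₀x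
  rw [expect_mul_diagonal_mul_star]
  simp only [hone]
  set q : Fin d → ℝ := fun k => ((star U * ω * U) k k).re with hq
  set p : Fin d → ℝ := fun k => ((star U * ν * U) k k).re with hp
  have hn' : (0 : ℝ) < n := by exact_mod_cast hn
  have hp0 : ∀ k, 0 ≤ p k := fun k => by
    obtain ⟨T, hT, h⟩ := exists_test_finset hU2 {k}
    have := h ν
    rw [Finset.sum_singleton] at this
    rw [hp]; dsimp only; rw [← this]
    exact expect_nonneg hν hT
  have hq0 : ∀ k, 0 ≤ q k := fun k => by
    obtain ⟨T, hT, h⟩ := exists_test_finset hU2 {k}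
    have := h ω
    rw [Finset.sum_singleton] at this
    rw [hq]; dsimp only; rw [← this]
    exact expect_nonneg hω hT
  have htr : ∀ ρ : Matrix (Fin d) (Fin d) ℂ, ρ.trace = 1 →
      ∑ k, ((star U * ρ * U) k k).re = 1 := fun ρ h => by
    have : Matrix.trace (star U * ρ * U) = 1 := by
      rw [Matrix.trace_mul_comm, ← Matrix.mul_assoc, hU1, Matrix.one_mul, h]
    rw [← Complex.re_sum]
    have h2 : ∑ k, (star U * ρ * U) k k = 1 := this
    rw [h2]; simp
  have hp1 : ∑ k, p k = 1 := htr ν hν1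
  have hq1 : ∑ k, q k = 1 := htr ω hω1
  -- Passing to a smallest subset that still carries `ω`-mass at least `1 - x` only lowers the
  -- type-II error, and removing any one index now drops the mass below `1 - x`.
  obtain ⟨s, hs, hmin⟩ := Finset.exists_min_image
    (s₀.powerset.filter fun s => 1 - x ≤ ∑ k ∈ s, q k) Finset.card
    ⟨s₀, Finset.mem_filter.2 ⟨Finset.mem_powerset_self _, by linarith⟩⟩
  obtain ⟨hs₀, hsx⟩ := Finset.mem_filter.1 hs
  rw [Finset.mem_powerset] at hs₀
  have hps : ∑ k ∈ s, p k ≤ ∑ k ∈ s₀, p k :=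
    Finset.sum_le_sum_of_subset_of_nonneg hs₀ fun k _ _ => hp0 k
  have hps0 : 0 ≤ ∑ k ∈ s, p k := Finset.sum_nonneg fun k _ => hp0 k
  have hmin' : ∀ i ∈ s, ∑ k ∈ s.erase i, q k < 1 - x := fun i hi => by
    by_contra! h
    have := hmin (s.erase i) (Finset.mem_filter.2
      ⟨Finset.mem_powerset.2 ((Finset.erase_subset _ _).trans hs₀), h⟩)
    have := Finset.card_erase_lt_of_mem hi
    omega
  have hplain : ∑ k ∈ s, q k ≤ 1 - x + 2 / n → ∃ T, IsStarProjection T ∧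
      |1 - expect ω T - x| ≤ 2 / n ∧ expect ν T ≤ 2 * ∑ k ∈ s₀, p k + 4 / n := fun h => by
    obtain ⟨T, hT, hTe⟩ := exists_test_finset hU2 s
    have : (0 : ℝ) ≤ 4 / n := by positivity
    refine ⟨T, hT, ?_, ?_⟩
    · rw [hTe ω, abs_le]; constructor <;> linarith
    · rw [hTe ν]; linarith
  have h2n : (0 : ℝ) < 2 / n := by positivity
  rcases s.eq_empty_or_nonempty with rfl | ⟨i₀, hi₀⟩
  · exact hplain (by rw [Finset.sum_empty]; linarith)
  by_cases hcard : n ≤ s.card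
  -- A large minimal set contains an index of mass at most `1 / n`, so its total mass already
  -- exceeds `1 - x` by no more than that.
  · obtain ⟨i, hi, hiq⟩ : ∃ i ∈ s, q i ≤ 1 / n := by
      by_contra! h
      have h1 : ∑ k ∈ s, (1 / n : ℝ) < ∑ k ∈ s, q k := Finset.sum_lt_sum_of_nonempty ⟨i₀, hi₀⟩ h
      have h2 : ∑ k ∈ s, q k ≤ 1 := hq1 ▸
        Finset.sum_le_sum_of_subset_of_nonneg (Finset.subset_univ s) fun k _ _ => hq0 k
      rw [Finset.sum_const, nsmul_eq_mul, mul_one_div] at h1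
      have h3 : (s.card : ℝ) / n < 1 := by linarith
      rw [div_lt_one hn'] at h3
      exact absurd hcard (by exact_mod_cast not_le.2 h3)
    refine hplain ?_
    have h1 := hmin' i hi
    have h2 := Finset.add_sum_erase s q hi
    have h3 : (1 : ℝ) / n ≤ 2 / n := by gcongr; norm_num
    linarith
  -- A small set leaves at least `n` free indices sharing total mass at most `2` under `p + q`. One
  -- of them is light for both states; rotating `i₀` into it lets the intermediate value theorem
  -- reach `1 - x`, unless the endpoint is still above and then already close enough.
  · obtain ⟨j, hj, hjq⟩ : ∃ j ∈ sᶜ, p j + q j ≤ 2 / n := by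
      by_contra! h
      have hc : n ≤ sᶜ.card := by rw [Finset.card_compl, Fintype.card_fin]; omega
      have h1 : ∑ k ∈ sᶜ, (2 / n : ℝ) < ∑ k ∈ sᶜ, (p k + q k) :=
        Finset.sum_lt_sum_of_nonempty (Finset.card_pos.1 (by omega)) h
      have h2 : ∑ k ∈ sᶜ, (p k + q k) ≤ 2 := by
        have : ∑ k, (p k + q k) = 2 := by rw [Finset.sum_add_distrib, hp1, hq1]; norm_num
        exact this ▸ Finset.sum_le_sum_of_subset_of_nonneg (Finset.subset_univ _)
          fun k _ _ => add_nonneg (hp0 k) (hq0 k)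
      rw [Finset.sum_const, nsmul_eq_mul, mul_div_assoc'] at h1
      have h3 : (sᶜ.card : ℝ) * 2 / n < 2 := by linarith
      rw [div_lt_iff₀ hn'] at h3
      have h4 : (n : ℝ) ≤ sᶜ.card := by exact_mod_cast hc
      linarith
    rw [Finset.mem_compl] at hj
    have hij : i₀ ≠ j := by rintro rfl; exact hj hi₀
    have hi' : i₀ ∉ s.erase i₀ := Finset.notMem_erase _ _
    have hj' : j ∉ s.erase i₀ := fun h => hj (Finset.mem_of_mem_erase h)
    have hsplit := Finset.add_sum_erase s q hi₀
    have hsplit' := Finset.add_sum_erase s p hi₀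
    have hrot : ∀ θ : ℝ, |∑ k ∈ s.erase i₀, q k + Real.cos θ ^ 2 * q i₀ + Real.sin θ ^ 2 * q j +
          Real.cos θ * Real.sin θ * ((star U * ω * U) i₀ j + (star U * ω * U) j i₀).re - (1 - x)|
            ≤ (2 / n : ℝ) → ∃ T, IsStarProjection T ∧
      |1 - expect ω T - x| ≤ 2 / n ∧ expect ν T ≤ 2 * ∑ k ∈ s₀, p k + 4 / n := fun θ hθ => by
      obtain ⟨T, hT, hTe⟩ := exists_test_rotation hU2 (s.erase i₀) hij hi' hj' (Real.cos θ)
        (Real.sin θ) (Real.cos_sq_add_sin_sq θ)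
      refine ⟨T, hT, ?_, ?_⟩
      · rw [hTe ω, ← abs_neg]
        convert hθ using 2
        ring
      -- The off-diagonal term has no sign. Positivity of `ν` on the oppositely rotated vector
      -- bounds it by the diagonal terms, which causes the factor `2` in the type-II bound.
      · obtain ⟨T', hT', hTe'⟩ := exists_test_rotation hU2 ∅ hij (by simp) (by simp) (Real.cos θ)
          (-Real.sin θ) (by rw [neg_sq]; exact Real.cos_sq_add_sin_sq θ)
        have h1 := expect_nonneg hν hT'
        have h2 := Real.cos_sq_le_one θ
        have h3 := Real.sin_sq_le_one θ
        rw [hTe' ν, Finset.sum_empty] at h1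
        rw [hTe ν]
        change 0 ≤ 0 + Real.cos θ ^ 2 * p i₀ + (-Real.sin θ) ^ 2 * p j + _ at h1
        change ∑ k ∈ s.erase i₀, p k + Real.cos θ ^ 2 * p i₀ + Real.sin θ ^ 2 * p j + _ ≤ _
        have h4 : Real.cos θ ^ 2 * p i₀ ≤ p i₀ := mul_le_of_le_one_left (hp0 _) h2
        have h5 : Real.sin θ ^ 2 * p j ≤ p j := mul_le_of_le_one_left (hp0 _) h3
        have h6 : (0 : ℝ) ≤ ∑ k ∈ s.erase i₀, p k := Finset.sum_nonneg fun k _ => hp0 k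
        have h7 : (4 : ℝ) / n = 2 * (2 / n) := by ring
        have h8 := hq0 j
        rw [h7]
        rw [neg_sq] at h1
        linarith
    set f : ℝ → ℝ := fun θ => ∑ k ∈ s.erase i₀, q k + Real.cos θ ^ 2 * q i₀ +
      Real.sin θ ^ 2 * q j +
        Real.cos θ * Real.sin θ * ((star U * ω * U) i₀ j + (star U * ω * U) j i₀).re with hf
    have hf0 : f 0 = ∑ k ∈ s, q k := by rw [hf]; simp [← hsplit]; ring
    have hf1 : f (Real.pi / 2) = ∑ k ∈ s.erase i₀, q k + q j := by rw [hf]; simp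
    by_cases hend : 1 - x ≤ f (Real.pi / 2)
    · refine hrot (Real.pi / 2) ?_
      have h1 := hmin' i₀ hi₀
      have h2 := hp0 j
      change |f (Real.pi / 2) - (1 - x)| ≤ _
      rw [abs_of_nonneg (by linarith), hf1]
      linarith
    · have hc : ContinuousOn f (Set.Icc 0 (Real.pi / 2)) := by
        rw [hf]; fun_prop
      obtain ⟨θ, -, hθ⟩ := intermediate_value_Icc' (by positivity) hc
        ⟨(not_le.1 hend).le, hsx.trans hf0.ge⟩
      refine hrot θ ?_
      change |f θ - (1 - x)| ≤ _
      rw [hθ, sub_self, abs_zero]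
      exact h2n.le

end

/-! ### Evolved states, and growth of the dimension. -/

section

namespace FiniteQuantumSystem

variable (Q : FiniteQuantumSystem)

theorem propagator_add (s t : ℝ) : Q.propagator (s + t) = Q.propagator s * Q.propagator t := by
  rw [propagator, propagator, propagator, ← Matrix.exp_add_of_commute]
  · congr 1
    rw [← add_smul]
    push_cast
    ring_nf
  · exact ((Commute.refl Q.H).smul_left _).smul_right _

theorem propagator_zero : Q.propagator 0 = 1 := by
  simp [propagator]

theorem propagator_neg_mul (t : ℝ) : Q.propagator (-t) * Q.propagator t = 1 := by
  rw [← propagator_add, neg_add_cancel, propagator_zero]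

theorem propagator_mul_neg (t : ℝ) : Q.propagator t * Q.propagator (-t) = 1 := by
  rw [← propagator_add, add_neg_cancel, propagator_zero]

theorem star_propagator (t : ℝ) : star (Q.propagator t) = Q.propagator (-t) := by
  rw [propagator, propagator, Matrix.star_eq_conjTranspose, ← Matrix.exp_conjTranspose,
    Matrix.conjTranspose_smul, Q.isHermitian_H.eq]
  congr 2
  simp

theorem propagator_mem_unitary (t : ℝ) :
    Q.propagator t ∈ unitary (Matrix (Fin Q.dim) (Fin Q.dim) ℂ) := by
  rw [Unitary.mem_iff, star_propagator]
  exact ⟨Q.propagator_neg_mul t, Q.propagator_mul_neg t⟩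

theorem cfc_state (f : ℝ → ℝ) (t : ℝ) :
    cfc f (Q.state t) = Q.propagator (-t) * cfc f Q.ω * Q.propagator t := by
  let φ := Unitary.conjStarAlgAut ℝ (Matrix (Fin Q.dim) (Fin Q.dim) ℂ)
    ⟨Q.propagator (-t), Q.propagator_mem_unitary (-t)⟩
  have hφ : ∀ A, φ A = Q.propagator (-t) * A * Q.propagator t := fun A => by
    have := Unitary.conjStarAlgAut_apply (S := ℝ)
      (⟨Q.propagator (-t), Q.propagator_mem_unitary (-t)⟩ :
        unitary (Matrix (Fin Q.dim) (Fin Q.dim) ℂ)) A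
    rw [this]
    change Q.propagator (-t) * A * star (Q.propagator (-t)) = _
    rw [star_propagator, neg_neg]
  have hc : Continuous φ := by
    have : (φ : _ → _) = fun A => Q.propagator (-t) * A * Q.propagator t := funext hφ
    rw [this]
    fun_prop
  rw [← hφ, state, ← hφ]
  refine (StarAlgHomClass.map_cfc φ f Q.ω (continuousOn_spectrum _ _) hc
    Q.posDef_ω.1.isSelfAdjoint ?_).symm
  exact Q.posDef_ω.1.isSelfAdjoint.map φ

theorem posDef_state (t : ℝ) : (Q.state t).PosDef := by
  have h := Q.posDef_ω.conjTranspose_mul_mul_same (B := Q.propagator t) ?_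
  · rwa [← Matrix.star_eq_conjTranspose, star_propagator] at h
  · intro v w hvw
    have := congrArg (Q.propagator (-t)).mulVec hvw
    simpa [Matrix.mulVec_mulVec, propagator_neg_mul] using this

theorem trace_state (t : ℝ) : (Q.state t).trace = 1 := by
  rw [state, Matrix.trace_mul_comm, ← Matrix.mul_assoc, propagator_mul_neg, Matrix.one_mul,
    Q.trace_ω]

theorem trace_cfc_state_mul_cfc_state (f g : ℝ → ℝ) (a b : ℝ) :
    Matrix.trace (cfc f (Q.state a) * cfc g (Q.state b)) =
      Matrix.trace (cfc f (Q.state (a - b)) * cfc g Q.ω) := by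
  rw [cfc_state, cfc_state, cfc_state, neg_sub, sub_eq_add_neg a b, sub_eq_add_neg b a,
    propagator_add, propagator_add, ← Matrix.mul_assoc _ _ (Q.propagator b), Matrix.trace_mul_comm]
  simp only [Matrix.mul_assoc]

theorem renyiEntropy_state (a b s : ℝ) :
    renyiEntropy (Q.state a) (Q.state b) s = Q.renyi (a - b) s := by
  rw [renyi, renyiEntropy, renyiEntropy, trace_cfc_state_mul_cfc_state]

end FiniteQuantumSystem

theorem renyiEntropy_symm {d : ℕ} (ν ω : Matrix (Fin d) (Fin d) ℂ) (s : ℝ) :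
    renyiEntropy ν ω s = renyiEntropy ω ν (1 - s) := by
  rw [renyiEntropy, renyiEntropy, Matrix.trace_mul_comm, sub_sub_cancel]

variable {d : ℕ}

theorem spectrum_le_one {A : Matrix (Fin d) (Fin d) ℂ} (hA : A.PosSemidef) (h1 : A.trace = 1) :
    ∀ x ∈ spectrum ℝ A, x ≤ 1 := by
  intro x hx
  rw [hA.1.spectrum_real_eq_range_eigenvalues] at hx
  obtain ⟨i, rfl⟩ := hx
  have h := hA.1.trace_eq_sum_eigenvalues
  rw [h1] at h
  have h2 : (1 : ℝ) = ∑ i, hA.1.eigenvalues i := by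
    have := congrArg Complex.re h
    simpa using this
  rw [h2]
  exact Finset.single_le_sum (fun i _ => hA.eigenvalues_nonneg i) (Finset.mem_univ i)

theorem posSemidef_cfc_rpow_sub_self {A : Matrix (Fin d) (Fin d) ℂ} (hA : A.PosSemidef)
    (h1 : A.trace = 1) {s : ℝ} (hs : s ∈ Set.Icc (0 : ℝ) 1) :
    (cfc (fun x : ℝ => x ^ s) A - A).PosSemidef := by
  have : cfc (fun x : ℝ => x ^ s) A - A = cfc (fun x : ℝ => x ^ s - x) A := by
    rw [cfc_sub _ _ _ (continuousOn_spectrum _ _) (continuousOn_spectrum _ _),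
      cfc_id' ℝ _ hA.1.isSelfAdjoint]
  rw [this]
  exact posSemidef_cfc _ fun x hx => sub_nonneg.2
    (Real.self_le_rpow_of_le_one (spectrum_nonneg hA x hx) (spectrum_le_one hA h1 x hx) hs.2)

/-- The eigenvalues of a density matrix lie in `[0, 1]`, so it is dominated by its powers with
exponent in `[0, 1]`. Small Rényi overlap thus forces near orthogonality. -/
theorem re_trace_mul_le {A B : Matrix (Fin d) (Fin d) ℂ} (hA : A.PosSemidef) (hB : B.PosSemidef)
    (hA1 : A.trace = 1) (hB1 : B.trace = 1) {s : ℝ} (hs : s ∈ Set.Icc (0 : ℝ) 1) :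
    (Matrix.trace (A * B)).re ≤
      (Matrix.trace (cfc (fun x : ℝ => x ^ s) A * cfc (fun x : ℝ => x ^ (1 - s)) B)).re := by
  have hs' : 1 - s ∈ Set.Icc (0 : ℝ) 1 := ⟨by linarith [hs.2], by linarith [hs.1]⟩
  have h1 := re_trace_mul_nonneg (posSemidef_cfc_rpow_sub_self hA hA1 hs) hB
  have h2 := re_trace_mul_nonneg (posSemidef_cfc_rpow hA s)
    (posSemidef_cfc_rpow_sub_self hB hB1 hs')
  simp only [Matrix.sub_mul, Matrix.mul_sub, Matrix.trace_sub, Complex.sub_re] at h1 h2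
  linarith

theorem sq_re_trace_le {V : Matrix (Fin d) (Fin d) ℂ} (hV : V.IsHermitian) :
    (Matrix.trace V).re ^ 2 ≤ d * (Matrix.trace (V * V)).re := by
  have h1 := re_trace_diagonal_mul_mul_star (fun _ => 1) V
  have h2 : star V = V := hV
  simp only [Complex.ofReal_one, Matrix.diagonal_one, one_mul, h2] at h1
  have h3 := sq_sum_le_card_mul_sum_sq (s := Finset.univ) (f := fun i => (V i i).re)
  rw [Finset.card_univ, Fintype.card_fin] at h3
  rw [h1, Matrix.trace, Complex.re_sum]
  refine h3.trans (mul_le_mul_of_nonneg_left (Finset.sum_le_sum fun i _ => ?_) (by positivity))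
  refine le_trans ?_ (Finset.single_le_sum (fun j _ => Complex.normSq_nonneg (V i j))
    (Finset.mem_univ i))
  rw [Complex.normSq_apply]
  nlinarith [sq_nonneg (V i i).im]

/-- A system with many pairwise almost orthogonal states has large dimension. -/
theorem card_le_dim_mul {K : ℕ} (ρ : ℕ → Matrix (Fin d) (Fin d) ℂ) (hρ : ∀ i, (ρ i).PosSemidef)
    (hρ1 : ∀ i, (ρ i).trace = 1) {η : ℝ} (hη : 0 ≤ η)
    (h : ∀ i < K, ∀ j < i, (Matrix.trace (ρ i * ρ j)).re ≤ η) :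
    (K : ℝ) ^ 2 ≤ d * (K + K ^ 2 * η) := by
  set V := ∑ i ∈ Finset.range K, ρ i with hV
  have hVh : V.IsHermitian := (Matrix.posSemidef_sum _ fun i _ => hρ i).1
  have h1 := sq_re_trace_le hVh
  have h2 : (Matrix.trace V).re = K := by
    rw [hV, Matrix.trace_sum]; simp [hρ1]
  rw [h2] at h1
  refine h1.trans (mul_le_mul_of_nonneg_left ?_ (by positivity))
  rw [hV, Finset.sum_mul_sum, Matrix.trace_sum, Complex.re_sum]
  have hb : ∀ i ∈ Finset.range K, (Matrix.trace (∑ j ∈ Finset.range K, ρ i * ρ j)).re ≤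
      1 + K * η := by
    intro i hi
    rw [Matrix.trace_sum, Complex.re_sum]
    have hb2 : ∀ j ∈ Finset.range K, (Matrix.trace (ρ i * ρ j)).re ≤
        (if i = j then 1 else 0) + η := by
      intro j hj
      rcases lt_trichotomy i j with hij | hij | hij
      · rw [if_neg hij.ne, zero_add, Matrix.trace_mul_comm]
        exact h j (Finset.mem_range.1 hj) i hij
      · subst hij
        rw [if_pos rfl]
        have := re_trace_mul_le (hρ i) (hρ i) (hρ1 i) (hρ1 i) (s := 1) (by simp)
        rw [cfc_rpow_mul_cfc_rpow_one_sub (hρ i), hρ1 i] at this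
        rw [Complex.one_re] at this
        linarith
      · rw [if_neg hij.ne', zero_add]
        exact h i (Finset.mem_range.1 hi) j hij
    refine (Finset.sum_le_sum hb2).trans ?_
    rw [Finset.sum_add_distrib, Finset.sum_ite_eq, if_pos hi]
    simp
  refine (Finset.sum_le_sum hb).trans (le_of_eq ?_)
  rw [Finset.sum_const, Finset.card_range, nsmul_eq_mul]
  ring

/-- Positivity rules out the default value of `Real.log` at `0`. If the trace vanished, all
Nussbaum-Szkoła weights would vanish, against `Tr ν = 1`. -/
theorem renyiEntropy_pos_arg {ν ω : Matrix (Fin d) (Fin d) ℂ} (hν : ν.PosDef) (hω : ω.PosDef)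
    (hν1 : ν.trace = 1) (s : ℝ) :
    0 < (Matrix.trace (cfc (fun x : ℝ => x ^ s) ν * cfc (fun x : ℝ => x ^ (1 - s)) ω)).re := by
  obtain ⟨p, l, μ, hp, hl, hμ, hfg, -⟩ := exists_nussbaumSzkola hν hω
  rw [hfg]
  have h1 := hfg id (fun _ => 1)
  rw [cfc_id ℝ ν hν.1.isSelfAdjoint, cfc_const_one ℝ ω hω.1.isSelfAdjoint, Matrix.mul_one, hν1]
    at h1
  have hnn : ∀ k ∈ Finset.univ, 0 ≤ p k * (l k ^ s * μ k ^ (1 - s)) := fun k _ =>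
    mul_nonneg (hp k) (mul_nonneg (Real.rpow_nonneg (hl k).le _) (Real.rpow_nonneg (hμ k).le _))
  refine (Finset.sum_nonneg hnn).lt_of_ne fun h0 => ?_
  have h2 := (Finset.sum_eq_zero_iff_of_nonneg hnn).1 h0.symm
  have h3 : ∀ k, p k = 0 := fun k => by
    rcases mul_eq_zero.1 (h2 k (Finset.mem_univ k)) with h | h
    · exact h
    · exact absurd h (mul_pos (Real.rpow_pos_of_pos (hl k) _) (Real.rpow_pos_of_pos (hμ k) _)).ne'
  simp [h3] at h1

theorem exp_renyiEntropy {ν ω : Matrix (Fin d) (Fin d) ℂ} (hν : ν.PosDef) (hω : ω.PosDef)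
    (hν1 : ν.trace = 1) (s : ℝ) : Real.exp (renyiEntropy ν ω s) =
      (Matrix.trace (cfc (fun x : ℝ => x ^ s) ν * cfc (fun x : ℝ => x ^ (1 - s)) ω)).re :=
  Real.exp_log (renyiEntropy_pos_arg hν hω hν1 s)

/-- A negative rate sends the overlap of `ω_t` and `ω_t'` to zero as `t - t'` grows, first in `m`
and then in time. States at the times `0, τ, 2τ, …` are then almost orthogonal, and a space of
bounded dimension cannot hold many of them. -/
theorem tendsto_dim_atTop {Q : ℕ → FiniteQuantumSystem} {s c : ℝ} {E : ℝ → ℝ}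
    (hs : s ∈ Set.Icc (0 : ℝ) 1)
    (hE : ∀ t : ℝ, 0 < t → Tendsto (fun m => (Q m).renyi t s) atTop (𝓝 (E t)))
    (hc : Tendsto (fun t : ℝ => (1 / t) * E t) atTop (𝓝 c)) (hc0 : c < 0) :
    Tendsto (fun m => (Q m).dim) atTop atTop := by
  have hbot : Tendsto E atTop atBot := by
    refine (Tendsto.atTop_mul_neg hc0 tendsto_id hc).congr' ?_
    filter_upwards [eventually_gt_atTop 0] with t ht
    simp only [id]
    field_simp
  refine tendsto_atTop.2 fun D => ?_
  -- With overlaps at most `1 / K`, `card_le_dim_mul` reads `K² ≤ 2 K dim`, so the dimension is at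
  -- least `K / 2 = D + 1`.
  set K : ℕ := 2 * D + 2 with hK
  have hKpos : (0 : ℝ) < K := by rw [hK]; positivity
  obtain ⟨τ, hτ⟩ := eventually_atTop.1 ((hbot.eventually_lt_atBot (Real.log (1 / K))).and
    (eventually_gt_atTop 0))
  have hτ0 : 0 < τ := (hτ τ le_rfl).2
  have hev : ∀ᶠ m in atTop, ∀ k ∈ Finset.range K, 0 < k →
      (Q m).renyi (k * τ) s < Real.log (1 / K) := by
    rw [eventually_all_finset]
    intro k _
    by_cases hk : 0 < k
    · have hk1 : (1 : ℝ) ≤ k := by exact_mod_cast hk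
      have hkτ := hτ (k * τ) (by nlinarith)
      filter_upwards [(hE _ hkτ.2).eventually_lt_const hkτ.1] with m hm _ using hm
    · exact Eventually.of_forall fun m h => absurd h hk
  filter_upwards [hev] with m hm
  by_contra! hlt
  have h := card_le_dim_mul (K := K) (fun i => (Q m).state (i * τ))
    (fun i => ((Q m).posDef_state _).posSemidef) (fun i => (Q m).trace_state _)
    (η := 1 / K) (by positivity) (fun i hi j hj => ?_)
  · have h1 : ((Q m).dim : ℝ) + 1 ≤ D := by exact_mod_cast hlt
    have h2 : (K : ℝ) = 2 * D + 2 := by rw [hK]; push_cast; ring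
    have h3 : (K : ℝ) ^ 2 * (1 / K) = K := by field_simp
    rw [h3] at h
    have h4 : (0 : ℝ) ≤ (Q m).dim := by positivity
    nlinarith
  · refine (re_trace_mul_le ((Q m).posDef_state _).posSemidef ((Q m).posDef_state _).posSemidef
      ((Q m).trace_state _) ((Q m).trace_state _) hs).trans ?_
    rw [← exp_renyiEntropy ((Q m).posDef_state _) ((Q m).posDef_state _) ((Q m).trace_state _),
      (Q m).renyiEntropy_state]
    have h5 := hm (i - j) (Finset.mem_range.2 (by omega)) (by omega)
    rw [Nat.cast_sub hj.le, sub_mul] at h5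
    rw [← Real.exp_log (show (0 : ℝ) < 1 / K by positivity)]
    exact Real.exp_le_exp.2 h5.le

end

/-! ### Calculus of iterated exponential rates. -/

section

theorem elog_mono {x y : ℝ} (h : x ≤ y) : elog x ≤ elog y :=
  ENNReal.log_monotone (ENNReal.ofReal_le_ofReal h)

theorem elog_exp (x : ℝ) : elog (Real.exp x) = x := by
  rw [elog, ENNReal.log_ofReal_of_pos (Real.exp_pos x), Real.log_exp]

theorem le_exp_of_elog_lt {x c : ℝ} (h : elog x < c) : x ≤ Real.exp c := by
  by_contra! hx
  have := elog_mono hx.le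
  rw [elog_exp] at this
  exact absurd h (not_lt.2 this)

theorem tendsto_elog {ι : Type*} {l : Filter ι} {x : ι → ℝ} {g : ℝ} (h : Tendsto x l (𝓝 g)) :
    Tendsto (fun i => elog (x i)) l (𝓝 (elog g)) :=
  (ENNReal.logHomeomorph.continuous.tendsto _).comp (ENNReal.tendsto_ofReal h)

theorem rate_mul_coe {t : ℝ} (ht : 0 < t) (c : ℝ) :
    ((1 / (2 * t) : ℝ) : EReal) * ((2 * t * c : ℝ) : EReal) = c := by
  rw [← EReal.coe_mul]
  congr 1
  field_simp

theorem rate_coe_nonneg {t : ℝ} (ht : 0 < t) : (0 : EReal) ≤ ((1 / (2 * t) : ℝ) : EReal) := by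
  exact_mod_cast (by positivity : (0 : ℝ) ≤ 1 / (2 * t))

theorem le_lowerRate {x : ℕ → ℝ → ℝ} {c : ℝ}
    (h : ∀ δ > 0, ∀ᶠ t in atTop, ∀ᶠ m in atTop, Real.exp (2 * t * (c - δ)) ≤ x m t) :
    (c : EReal) ≤ lowerRate x := by
  refine EReal.ge_of_forall_gt_iff_ge.1 fun z hz => ?_
  have hz' : z < c := by exact_mod_cast hz
  refine le_liminf_of_le (by isBoundedDefault) ?_
  filter_upwards [h (c - z) (sub_pos.2 hz'), eventually_gt_atTop 0] with t ht ht0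
  rw [← rate_mul_coe ht0 z]
  refine mul_le_mul_of_nonneg_left ?_ (rate_coe_nonneg ht0)
  refine le_liminf_of_le (by isBoundedDefault) ?_
  filter_upwards [ht] with m hm
  rw [sub_sub_cancel] at hm
  rw [← elog_exp]
  exact elog_mono hm

theorem upperRate_le {x : ℕ → ℝ → ℝ} {c : ℝ}
    (h : ∀ δ > 0, ∀ᶠ t in atTop, ∀ᶠ m in atTop, x m t ≤ Real.exp (2 * t * (c + δ))) :
    upperRate x ≤ c := by
  refine EReal.le_of_forall_lt_iff_le.1 fun z hz => ?_
  have hz' : c < z := by exact_mod_cast hz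
  refine limsup_le_of_le (by isBoundedDefault) ?_
  filter_upwards [h (z - c) (sub_pos.2 hz'), eventually_gt_atTop 0] with t ht ht0
  rw [← rate_mul_coe ht0 z]
  refine mul_le_mul_of_nonneg_left ?_ (rate_coe_nonneg ht0)
  refine limsup_le_of_le (by isBoundedDefault) ?_
  filter_upwards [ht] with m hm
  rw [add_sub_cancel] at hm
  rw [← elog_exp]
  exact elog_mono hm

theorem lowerRate_le_upperRate (x : ℕ → ℝ → ℝ) : lowerRate x ≤ upperRate x := by
  refine (liminf_le_liminf ?_ ).trans liminf_le_limsup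
  filter_upwards [eventually_gt_atTop 0] with t ht
  exact mul_le_mul_of_nonneg_left liminf_le_limsup (rate_coe_nonneg ht)

theorem exists_le_exp_of_upperRate_lt {x : ℕ → ℝ → ℝ} {c : ℝ} (h : upperRate x < c) :
    ∃ c' < c, ∀ᶠ t in atTop, ∀ᶠ m in atTop, x m t ≤ Real.exp (2 * t * c') := by
  obtain ⟨c', h1, h2⟩ := EReal.lt_iff_exists_real_btwn.1 h
  refine ⟨c', by exact_mod_cast h2, ?_⟩
  filter_upwards [eventually_lt_of_limsup_lt h1 (by isBoundedDefault), eventually_gt_atTop 0]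
    with t ht ht0
  have h3 : limsup (fun m => elog (x m t)) atTop < ((2 * t * c' : ℝ) : EReal) := by
    by_contra! h4
    have := mul_le_mul_of_nonneg_left h4 (rate_coe_nonneg ht0)
    rw [rate_mul_coe ht0] at this
    exact absurd ht (not_lt.2 this)
  filter_upwards [eventually_lt_of_limsup_lt h3 (by isBoundedDefault)] with m hm
  exact le_exp_of_elog_lt hm

theorem HasRate.lowerRate_eq {x : ℕ → ℝ → ℝ} {b : EReal} (h : HasRate x b) :
    lowerRate x = b := by
  obtain ⟨L, h1, h2⟩ := h
  rw [lowerRate, ← h2.liminf_eq]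
  refine liminf_congr ?_
  filter_upwards [eventually_gt_atTop 0] with t ht
  rw [(h1 t ht).liminf_eq]

theorem HasRate.upperRate_eq {x : ℕ → ℝ → ℝ} {b : EReal} (h : HasRate x b) :
    upperRate x = b := by
  obtain ⟨L, h1, h2⟩ := h
  rw [upperRate, ← h2.limsup_eq]
  refine limsup_congr ?_
  filter_upwards [eventually_gt_atTop 0] with t ht
  rw [(h1 t ht).limsup_eq]

theorem hasRate_of_tendsto {x : ℕ → ℝ → ℝ} {g : ℝ → ℝ} {b : ℝ}
    (h : ∀ t, 0 < t → Tendsto (fun m => x m t) atTop (𝓝 (g t)))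
    (hg : ∀ᶠ t in atTop, g t = Real.exp (2 * t * b)) : HasRate x b := by
  refine ⟨fun t => elog (g t), fun t ht => tendsto_elog (h t ht), ?_⟩
  refine tendsto_const_nhds.congr' ?_
  filter_upwards [hg, eventually_gt_atTop 0] with t ht ht0
  rw [ht, elog_exp, rate_mul_coe ht0]

/-- The three infima of type-I rates over a class `C` of families of tests agree as soon as every
lower rate is at least `c` and existing rates come arbitrarily close to `c`. -/
theorem sInf_rates_eq {β : Type*} {C : β → Prop} {x : β → ℕ → ℝ → ℝ} {c : EReal}
    (hlow : ∀ T, C T → c ≤ lowerRate (x T))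
    (hup : ∀ c' : ℝ, c < c' → ∃ T, C T ∧ ∃ b : ℝ, b ≤ c' ∧ HasRate (x T) b) :
    sInf {b : EReal | ∃ T, C T ∧ b = lowerRate (x T)} = c ∧
    sInf {b : EReal | ∃ T, C T ∧ b = upperRate (x T)} = c ∧
    sInf {b : EReal | ∃ T, C T ∧ HasRate (x T) b} = c := by
  refine ⟨le_antisymm ?_ ?_, le_antisymm ?_ ?_, le_antisymm ?_ ?_⟩
  · refine EReal.le_of_forall_lt_iff_le.1 fun z hz => ?_
    obtain ⟨T, hT, b, hb, hr⟩ := hup z hz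
    refine le_trans (sInf_le (a := (b : EReal)) ?_) (EReal.coe_le_coe_iff.2 hb)
    exact ⟨T, hT, hr.lowerRate_eq.symm⟩
  · refine le_sInf ?_
    rintro _ ⟨T, hT, rfl⟩
    exact hlow T hT
  · refine EReal.le_of_forall_lt_iff_le.1 fun z hz => ?_
    obtain ⟨T, hT, b, hb, hr⟩ := hup z hz
    refine le_trans (sInf_le (a := (b : EReal)) ?_) (EReal.coe_le_coe_iff.2 hb)
    exact ⟨T, hT, hr.upperRate_eq.symm⟩
  · refine le_sInf ?_
    rintro _ ⟨T, hT, rfl⟩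
    exact (hlow T hT).trans (lowerRate_le_upperRate _)
  · refine EReal.le_of_forall_lt_iff_le.1 fun z hz => ?_
    obtain ⟨T, hT, b, hb, hr⟩ := hup z hz
    refine le_trans (sInf_le (a := (b : EReal)) ?_) (EReal.coe_le_coe_iff.2 hb)
    exact ⟨T, hT, hr⟩
  · refine le_sInf ?_
    rintro b ⟨T, hT, hr⟩
    exact hr.lowerRate_eq ▸ hlow T hT

end

/-! ### Error bounds for a single pair of states. -/

section

section Laplace

variable {ι : Type*} [Fintype ι] {w y : ι → ℝ}

/-- The exponential Markov inequality on both sides of `c`, for the law tilted by `s`. -/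
theorem sum_tail_le (hw : ∀ k, 0 ≤ w k) {s c κ u : ℝ} (hu : 0 < u) :
    ∑ k, (if |y k - c| ≤ κ then 0 else w k * Real.exp ((s - 1) * y k)) ≤
      Real.exp (-u * (c + κ)) * ∑ k, w k * Real.exp ((s + u - 1) * y k) +
      Real.exp (u * (c - κ)) * ∑ k, w k * Real.exp ((s - u - 1) * y k) := by
  rw [Finset.mul_sum, Finset.mul_sum, ← Finset.sum_add_distrib]
  refine Finset.sum_le_sum fun k _ => ?_
  have h1 : Real.exp (-u * (c + κ)) * (w k * Real.exp ((s + u - 1) * y k)) =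
      w k * Real.exp ((s - 1) * y k) * Real.exp (u * (y k - c - κ)) := by
    rw [mul_left_comm, mul_assoc, ← Real.exp_add, ← Real.exp_add]
    ring_nf
  have h2 : Real.exp (u * (c - κ)) * (w k * Real.exp ((s - u - 1) * y k)) =
      w k * Real.exp ((s - 1) * y k) * Real.exp (u * (c - κ - y k)) := by
    rw [mul_left_comm, mul_assoc, ← Real.exp_add, ← Real.exp_add]
    ring_nf
  rw [h1, h2, ← mul_add]
  have h3 : 0 ≤ w k * Real.exp ((s - 1) * y k) := mul_nonneg (hw k) (Real.exp_pos _).le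
  have e1 := Real.exp_pos (u * (y k - c - κ))
  have e2 := Real.exp_pos (u * (c - κ - y k))
  split_ifs with h
  · positivity
  · refine le_mul_of_one_le_right h3 ?_
    rw [abs_le, not_and_or] at h
    rcases h with h | h
    · have := Real.one_le_exp (show 0 ≤ u * (c - κ - y k) from mul_nonneg hu.le (by linarith))
      linarith
    · have := Real.one_le_exp (show 0 ≤ u * (y k - c - κ) from mul_nonneg hu.le (by linarith))
      linarith

/-- On the window `|y - c| ≤ κ`, the factor `e^c / (e^y + e^c)` agrees with `e^((1-s)(c-y))` up to
the loss `e^(-2κ) / 2`; outside the window it is merely nonnegative. -/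
theorem le_sum_div_of_tilt (hw : ∀ k, 0 ≤ w k) {s c κ : ℝ} (hs : s ∈ Set.Icc (0 : ℝ) 1) :
    1 / 2 * Real.exp ((1 - s) * c - 2 * κ) * (∑ k, w k * Real.exp ((s - 1) * y k) -
      ∑ k, (if |y k - c| ≤ κ then 0 else w k * Real.exp ((s - 1) * y k))) ≤
      ∑ k, w k * (Real.exp c / (Real.exp (y k) + Real.exp c)) := by
  rw [← Finset.sum_sub_distrib, Finset.mul_sum]
  refine Finset.sum_le_sum fun k _ => ?_
  have hpos : 0 ≤ w k * (Real.exp c / (Real.exp (y k) + Real.exp c)) :=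
    mul_nonneg (hw k) (by positivity)
  split_ifs with h
  · rw [sub_zero, mul_left_comm]
    refine mul_le_mul_of_nonneg_left ?_ (hw k)
    have e : 1 / 2 * Real.exp ((1 - s) * c - 2 * κ) * Real.exp ((s - 1) * y k) *
        (Real.exp (y k) + Real.exp c) =
        1 / 2 * (Real.exp ((1 - s) * c - 2 * κ + (s - 1) * y k + y k) +
          Real.exp ((1 - s) * c - 2 * κ + (s - 1) * y k + c)) := by
      simp only [Real.exp_add]
      ring
    rw [le_div_iff₀ (by positivity), e]
    obtain ⟨ha, hb⟩ := abs_le.1 h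
    obtain ⟨h0, h1⟩ := hs
    have i1 : Real.exp ((1 - s) * c - 2 * κ + (s - 1) * y k + y k) ≤ Real.exp c := by
      refine Real.exp_le_exp.2 ?_
      nlinarith
    have i2 : Real.exp ((1 - s) * c - 2 * κ + (s - 1) * y k + c) ≤ Real.exp c := by
      refine Real.exp_le_exp.2 ?_
      nlinarith
    linarith
  · rw [sub_self, mul_zero]
    exact hpos

/-- A version at `s = 1` that loses no constant fraction. Raising the threshold to `c + 2κ` puts it
at least `κ` above `y` on the window, so the ratio there is at least `1 - e^(-κ)`. This is what lets
the Stein exponent hold for every `ε < 1`. -/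
theorem le_sum_div_of_upper_tail (hw : ∀ k, 0 ≤ w k) (hw1 : ∑ k, w k = 1) {c κ : ℝ} (hκ : 0 ≤ κ) :
    (1 - Real.exp (-κ)) * (1 - ∑ k, (if |y k - c| ≤ κ then 0 else w k)) ≤
      ∑ k, w k * (Real.exp (c + 2 * κ) / (Real.exp (y k) + Real.exp (c + 2 * κ))) := by
  rw [← hw1, ← Finset.sum_sub_distrib, Finset.mul_sum]
  refine Finset.sum_le_sum fun k _ => ?_
  have hpos : 0 ≤ w k * (Real.exp (c + 2 * κ) / (Real.exp (y k) + Real.exp (c + 2 * κ))) :=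
    mul_nonneg (hw k) (by positivity)
  split_ifs with h
  · rw [sub_zero, mul_comm]
    refine mul_le_mul_of_nonneg_left ?_ (hw k)
    obtain ⟨ha, hb⟩ := abs_le.1 h
    have i0 : Real.exp (y k) ≤ Real.exp (-κ) * Real.exp (c + 2 * κ) := by
      rw [← Real.exp_add]
      exact Real.exp_le_exp.2 (by linarith)
    have i1 : Real.exp (-κ) ≤ 1 := Real.exp_le_one_iff.2 (by linarith)
    have i2 := Real.exp_pos (y k)
    have i3 := Real.exp_pos (c + 2 * κ)
    have i4 := Real.exp_pos (-κ)
    rw [le_div_iff₀ (by positivity)]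
    nlinarith
  · rw [sub_self, mul_zero]
    exact hpos

end Laplace

variable {d : ℕ}

/-- The law of the logarithm of the relative modular operator of two states. -/
theorem exists_modular_law {ν ω : Matrix (Fin d) (Fin d) ℂ} (hν : ν.PosDef) (hω : ω.PosDef)
    (hν1 : ν.trace = 1) :
    ∃ w y : Fin d × Fin d → ℝ, (∀ k, 0 ≤ w k) ∧ ∑ k, w k = 1 ∧
      (∀ s, Real.exp (renyiEntropy ν ω s) = ∑ k, w k * Real.exp ((s - 1) * y k)) ∧
      (∀ T, IsStarProjection T → ∀ a : ℝ, 0 < a →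
        ∑ k, w k * (a / (Real.exp (y k) + a)) ≤ expect ν T + a * expect ω (1 - T)) ∧
      (Matrix.trace (cfc (fun x => x * Real.log x) ν)).re -
        (Matrix.trace (ν * cfc Real.log ω)).re = ∑ k, w k * y k := by
  obtain ⟨p, l, μ, hp, hl, hμ, hfg, hT⟩ := exists_nussbaumSzkola hν hω
  have hexp : ∀ k, Real.exp (Real.log (l k) - Real.log (μ k)) = l k / μ k := fun k => by
    rw [Real.exp_sub, Real.exp_log (hl k), Real.exp_log (hμ k)]
  refine ⟨fun k => p k * l k, fun k => Real.log (l k) - Real.log (μ k),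
    fun k => mul_nonneg (hp k) (hl k).le, ?_, fun s => ?_, fun T hTp a ha => ?_, ?_⟩
  · have h1 := hfg id (fun _ => 1)
    rw [cfc_id ℝ ν hν.1.isSelfAdjoint, cfc_const_one ℝ ω hω.1.isSelfAdjoint, Matrix.mul_one, hν1]
      at h1
    simpa using h1.symm
  · rw [exp_renyiEntropy hν hω hν1, hfg]
    refine Finset.sum_congr rfl fun k _ => ?_
    rw [mul_assoc, Real.rpow_def_of_pos (hl k), Real.rpow_def_of_pos (hμ k), ← Real.exp_add]
    congr 1
    nth_rewrite 2 [← Real.exp_log (hl k)]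
    rw [← Real.exp_add]
    ring_nf
  · refine le_trans (le_of_eq (Finset.sum_congr rfl fun k _ => ?_)) (hT T hTp a ha)
    rw [hexp]
    have := hl k
    have := hμ k
    field_simp
  · have h1 := hfg (fun x => x * Real.log x) (fun _ => 1)
    have h2 := hfg id Real.log
    rw [cfc_const_one ℝ ω hω.1.isSelfAdjoint, Matrix.mul_one] at h1
    rw [cfc_id ℝ ν hν.1.isSelfAdjoint] at h2
    rw [h1, h2, ← Finset.sum_sub_distrib]
    refine Finset.sum_congr rfl fun k _ => ?_
    simp only [id]
    ring

/-- The hypotheses on `s ± u` make each tail of the tilted law at most a quarter of its mass, so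
half remains on the window; the other half in `1 / 4` comes from `le_sum_div_of_tilt`. -/
theorem le_error_of_renyiEntropy_le {ν ω : Matrix (Fin d) (Fin d) ℂ} (hν : ν.PosDef)
    (hω : ω.PosDef) (hν1 : ν.trace = 1) {s c κ u : ℝ} (hs : s ∈ Set.Icc (0 : ℝ) 1) (hu : 0 < u)
    (h1 : renyiEntropy ν ω (s + u) ≤ renyiEntropy ν ω s + u * (c + κ) - Real.log 4)
    (h2 : renyiEntropy ν ω (s - u) ≤ renyiEntropy ν ω s - u * (c - κ) - Real.log 4)
    {T : Matrix (Fin d) (Fin d) ℂ} (hT : IsStarProjection T) :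
    1 / 4 * Real.exp (renyiEntropy ν ω s - 2 * κ) ≤
      Real.exp (-(1 - s) * c) * expect ν T + Real.exp (s * c) * expect ω (1 - T) := by
  obtain ⟨w, y, hw, -, hR, hlow, -⟩ := exists_modular_law hν hω hν1
  have h3 := le_sum_div_of_tilt (y := y) hw (c := c) (κ := κ) hs
  have h4 := sum_tail_le (y := y) hw (s := s) (c := c) (κ := κ) hu
  rw [← hR] at h3
  rw [← hR, ← hR, ← Real.exp_add, ← Real.exp_add] at h4
  have e4 : Real.exp (renyiEntropy ν ω s) / 4 = Real.exp (renyiEntropy ν ω s - Real.log 4) := by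
    rw [Real.exp_sub, Real.exp_log (by norm_num)]
  have h5 : Real.exp (-u * (c + κ) + renyiEntropy ν ω (s + u)) ≤
      Real.exp (renyiEntropy ν ω s) / 4 := by
    rw [e4]
    exact Real.exp_le_exp.2 (by linarith)
  have h6 : Real.exp (u * (c - κ) + renyiEntropy ν ω (s - u)) ≤
      Real.exp (renyiEntropy ν ω s) / 4 := by
    rw [e4]
    exact Real.exp_le_exp.2 (by linarith)
  have h7 := h3.trans (hlow T hT (Real.exp c) (Real.exp_pos c))
  have h8 : Real.exp (renyiEntropy ν ω s) / 2 ≤ Real.exp (renyiEntropy ν ω s) -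
      ∑ k, (if |y k - c| ≤ κ then 0 else w k * Real.exp ((s - 1) * y k)) := by linarith
  have h9 := (mul_le_mul_of_nonneg_left h8 (by positivity :
    0 ≤ 1 / 2 * Real.exp ((1 - s) * c - 2 * κ))).trans h7
  have h10 := mul_le_mul_of_nonneg_left h9 (Real.exp_pos (-(1 - s) * c)).le
  have e1 : Real.exp (-(1 - s) * c) * Real.exp c = Real.exp (s * c) := by
    rw [← Real.exp_add]; ring_nf
  have e2 : Real.exp (-(1 - s) * c) * (1 / 2 * Real.exp ((1 - s) * c - 2 * κ) *
      (Real.exp (renyiEntropy ν ω s) / 2)) = 1 / 4 * Real.exp (renyiEntropy ν ω s - 2 * κ) := by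
    have : Real.exp (renyiEntropy ν ω s - 2 * κ) = Real.exp (-(1 - s) * c) *
        Real.exp ((1 - s) * c - 2 * κ) * Real.exp (renyiEntropy ν ω s) := by
      rw [← Real.exp_add, ← Real.exp_add]; ring_nf
    rw [this]; ring
  rw [e2, mul_add, ← mul_assoc, e1] at h10
  exact h10

theorem le_error_of_renyiEntropy_le_one {ν ω : Matrix (Fin d) (Fin d) ℂ} (hν : ν.PosDef)
    (hω : ω.PosDef) (hν1 : ν.trace = 1) {c κ u L : ℝ} (hu : 0 < u) (hκ : 0 ≤ κ)
    (h1 : renyiEntropy ν ω (1 + u) ≤ u * (c + κ) - L)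
    (h2 : renyiEntropy ν ω (1 - u) ≤ - u * (c - κ) - L)
    {T : Matrix (Fin d) (Fin d) ℂ} (hT : IsStarProjection T) :
    1 - Real.exp (-κ) - 2 * Real.exp (-L) ≤
      expect ν T + Real.exp (c + 2 * κ) * expect ω (1 - T) := by
  obtain ⟨w, y, hw, hw1, hR, hlow, -⟩ := exists_modular_law hν hω hν1
  have h3 := le_sum_div_of_upper_tail (y := y) hw hw1 (c := c) hκ
  have h4 := sum_tail_le (y := y) hw (s := 1) (c := c) (κ := κ) hu
  simp only [sub_self, zero_mul, Real.exp_zero, mul_one] at h4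
  rw [← hR, ← hR, ← Real.exp_add, ← Real.exp_add] at h4
  have h5 : Real.exp (-u * (c + κ) + renyiEntropy ν ω (1 + u)) ≤ Real.exp (-L) :=
    Real.exp_le_exp.2 (by linarith)
  have h6 : Real.exp (u * (c - κ) + renyiEntropy ν ω (1 - u)) ≤ Real.exp (-L) :=
    Real.exp_le_exp.2 (by linarith)
  refine le_trans ?_ (h3.trans (hlow T hT _ (Real.exp_pos _)))
  have i1 : Real.exp (-κ) ≤ 1 := Real.exp_le_one_iff.2 (by linarith)
  have i2 := Real.exp_pos (-κ)
  have i3 := Real.exp_pos (-L)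
  set S := ∑ k, (if |y k - c| ≤ κ then 0 else w k)
  have : (1 - Real.exp (-κ)) * (1 - 2 * Real.exp (-L)) ≤ (1 - Real.exp (-κ)) * (1 - S) :=
    mul_le_mul_of_nonneg_left (by linarith) (by linarith)
  nlinarith

/-- The Chernoff bound for the pair `ν`, `exp α • ω`: each of the two nonnegative errors is below
their weighted sum, and `α` trades one exponent against the other. -/
theorem exists_test_weighted_le {ν ω : Matrix (Fin d) (Fin d) ℂ} (hν : ν.PosDef)
    (hω : ω.PosDef) (hν1 : ν.trace = 1) {s : ℝ} (hs : s ∈ Set.Icc (0 : ℝ) 1) (α : ℝ) :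
    ∃ T, IsStarProjection T ∧
      expect ν T ≤ Real.exp ((1 - s) * α + renyiEntropy ν ω s) ∧
      expect ω (1 - T) ≤ Real.exp (-s * α + renyiEntropy ν ω s) := by
  have hω' : ((Real.exp α) • ω).PosSemidef := hω.posSemidef.smul (Real.exp_pos α).le
  obtain ⟨T, hT, h⟩ := exists_test_le_trace_rpow hν.posSemidef hω' hs
  have hsm : cfc (fun x : ℝ => x ^ (1 - s)) (Real.exp α • ω) =
      Real.exp ((1 - s) * α) • cfc (fun x : ℝ => x ^ (1 - s)) ω := by
    rw [← cfc_comp_smul (Real.exp α) (fun x : ℝ => x ^ (1 - s)) ω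
      ((Matrix.finite_real_spectrum.image _).continuousOn _) hω.1.isSelfAdjoint,
      ← cfc_smul _ _ _ (continuousOn_spectrum ω _)]
    refine cfc_congr fun x hx => ?_
    simp only [smul_eq_mul]
    rw [Real.mul_rpow (Real.exp_pos α).le (spectrum_pos hω x hx).le, ← Real.exp_mul, mul_comm α]
  refine ⟨T, hT, ?_⟩
  have e1 : expect (Real.exp α • ω) (1 - T) = Real.exp α * expect ω (1 - T) := by
    rw [expect, Matrix.smul_mul, Matrix.trace_smul, Complex.real_smul, Complex.re_ofReal_mul, expect]
  have e2 : ((cfc (fun x : ℝ => x ^ s) ν *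
      (Real.exp ((1 - s) * α) • cfc (fun x : ℝ => x ^ (1 - s)) ω)).trace).re =
      Real.exp ((1 - s) * α + renyiEntropy ν ω s) := by
    rw [Real.exp_add, exp_renyiEntropy hν hω hν1, Matrix.mul_smul, Matrix.trace_smul,
      Complex.real_smul, Complex.re_ofReal_mul]
  rw [hsm, e1, e2] at h
  have p1 := expect_nonneg hν.posSemidef hT
  have p2 := expect_nonneg hω.posSemidef hT.one_sub
  refine ⟨by nlinarith [Real.exp_pos α], ?_⟩
  have : Real.exp α * expect ω (1 - T) ≤ Real.exp α * Real.exp (-s * α + renyiEntropy ν ω s) := by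
    rw [← Real.exp_add]
    refine le_trans (by linarith) (h.trans (le_of_eq ?_))
    ring_nf
  exact le_of_mul_le_mul_left this (Real.exp_pos α)

end

/-! ### Families of states with a differentiable rate function. -/

section

/-- `lim_t (1/2t) lim_m Ent_s(ν_{mt}|ω_{mt}) = c`, in a weak sense. -/
def HasRenyiRate {d : ℕ → ℕ} (ν ω : MatrixFamily d) (s c : ℝ) : Prop :=
  ∀ η : ℝ, 0 < η → ∀ᶠ t : ℝ in atTop, ∀ᶠ m : ℕ in atTop,
    |renyiEntropy (ν m t) (ω m t) s - 2 * t * c| ≤ 2 * t * η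

/-- Pairs of families of states on systems of growing dimension whose Rényi entropies have a
differentiable rate function. -/
structure IsRegularPair {d : ℕ → ℕ} (ν ω : MatrixFamily d) (f : ℝ → ℝ) : Prop where
  posDef_left : ∀ m t, (ν m t).PosDef
  posDef_right : ∀ m t, (ω m t).PosDef
  trace_left : ∀ m t, (ν m t).trace = 1
  trace_right : ∀ m t, (ω m t).trace = 1
  dim : Tendsto d atTop atTop
  rate : ∀ s ∈ Set.Icc (0 : ℝ) 1, ∀ᶠ v in 𝓝 s, HasRenyiRate ν ω v (f v)
  differentiable : ∀ s ∈ Set.Icc (0 : ℝ) 1, DifferentiableAt ℝ f s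

variable {d : ℕ → ℕ} {ν ω : MatrixFamily d} {f : ℝ → ℝ}

theorem renyiEntropy_one {d : ℕ} {ν ω : Matrix (Fin d) (Fin d) ℂ} (hν : ν.PosDef) (hω : ω.PosDef)
    (hν1 : ν.trace = 1) : renyiEntropy ν ω 1 = 0 := by
  simp only [renyiEntropy, sub_self, Real.rpow_one, Real.rpow_zero]
  rw [cfc_id' ℝ ν hν.1.isSelfAdjoint, cfc_const_one ℝ ω hω.1.isSelfAdjoint, Matrix.mul_one, hν1]
  simp

theorem expect_one_sub_zero {d : ℕ} {ω : Matrix (Fin d) (Fin d) ℂ} (hω : ω.trace = 1) :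
    expect ω (1 - 0) = 1 := by
  simp [expect, hω]

theorem expect_zero {d : ℕ} (ω : Matrix (Fin d) (Fin d) ℂ) : expect ω 0 = 0 := by
  simp [expect]

/-- Differentiability enters almost everywhere through this symmetric pair of increments, at which a
further neighbourhood property `P` also holds. Convexity of `f` is never invoked. -/
theorem exists_symmetric_slope {s δ : ℝ} {P : ℝ → Prop} (hf : DifferentiableAt ℝ f s)
    (hP : ∀ᶠ v in 𝓝 s, P v) (hδ : 0 < δ) :
    ∃ u > 0, P (s + u) ∧ P (s - u) ∧ f (s + u) ≤ f s + u * (deriv f s + δ) ∧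
      f (s - u) ≤ f s - u * (deriv f s - δ) := by
  have h1 := (hasDerivAt_iff_isLittleO.1 hf.hasDerivAt).def hδ
  obtain ⟨ε, hε, h⟩ := Metric.eventually_nhds_iff.1 (h1.and hP)
  have hp := h (show dist (s + ε / 2) s < ε by
    rw [Real.dist_eq, add_sub_cancel_left, abs_of_pos (by positivity)]; linarith)
  have hm := h (show dist (s - ε / 2) s < ε by
    rw [Real.dist_eq, sub_sub_cancel_left, abs_neg, abs_of_pos (by positivity)]; linarith)
  refine ⟨ε / 2, by positivity, hp.2, hm.2, ?_, ?_⟩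
  · have := (abs_le.1 hp.1).2
    rw [add_sub_cancel_left, Real.norm_eq_abs, abs_of_pos (by positivity), smul_eq_mul] at this
    linarith
  · have := (abs_le.1 hm.1).2
    rw [sub_sub_cancel_left, Real.norm_eq_abs, abs_neg, abs_of_pos (by positivity),
      smul_eq_mul] at this
    linarith

namespace IsRegularPair

theorem swap (h : IsRegularPair ν ω f) : IsRegularPair ω ν (fun s => f (1 - s)) where
  posDef_left := h.posDef_right
  posDef_right := h.posDef_left
  trace_left := h.trace_right
  trace_right := h.trace_left
  dim := h.dim
  rate s hs := by
    have hs' : 1 - s ∈ Set.Icc (0 : ℝ) 1 := ⟨by linarith [hs.2], by linarith [hs.1]⟩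
    have hc : Tendsto (fun v : ℝ => 1 - v) (𝓝 s) (𝓝 (1 - s)) :=
      (continuous_const.sub continuous_id).tendsto s
    filter_upwards [hc.eventually (h.rate _ hs')] with v hv η hη
    filter_upwards [hv η hη] with t ht
    filter_upwards [ht] with m hm
    rwa [renyiEntropy_symm]
  differentiable s hs := by
    have hs' : 1 - s ∈ Set.Icc (0 : ℝ) 1 := ⟨by linarith [hs.2], by linarith [hs.1]⟩
    exact DifferentiableAt.comp (g := f) (f := fun s => 1 - s) s (h.differentiable _ hs')
      (by fun_prop)

theorem hasRenyiRate (h : IsRegularPair ν ω f) {s : ℝ} (hs : s ∈ Set.Icc (0 : ℝ) 1) :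
    HasRenyiRate ν ω s (f s) := (h.rate s hs).self_of_nhds

theorem apply_one (h : IsRegularPair ν ω f) : f 1 = 0 := by
  by_contra hne
  have hpos : 0 < |f 1| / 2 := by positivity
  obtain ⟨t, ht, ht0⟩ := ((h.hasRenyiRate (s := 1) (by simp) _ hpos).and
    (eventually_gt_atTop 0)).exists
  obtain ⟨m, hm⟩ := ht.exists
  rw [renyiEntropy_one (h.posDef_left m t) (h.posDef_right m t) (h.trace_left m t), zero_sub,
    abs_neg, abs_mul, abs_of_pos (by positivity)] at hm
  have := le_of_mul_le_mul_left hm (by positivity)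
  linarith

theorem apply_zero (h : IsRegularPair ν ω f) : f 0 = 0 := by
  simpa using h.swap.apply_one

theorem continuousOn (h : IsRegularPair ν ω f) : ContinuousOn f (Set.Icc 0 1) :=
  fun s hs => (h.differentiable s hs).continuousAt.continuousWithinAt

/-- The tilted law concentrates at the slope, so `le_error_of_renyiEntropy_le` applies with `c = 2 t
f'(s)` and a window of width proportional to `t`. -/
theorem eventually_le_error (h : IsRegularPair ν ω f) {s : ℝ} (hs : s ∈ Set.Icc (0 : ℝ) 1)
    {δ : ℝ} (hδ : 0 < δ) : ∀ᶠ t : ℝ in atTop, ∀ᶠ m in atTop, ∀ T, IsStarProjection T →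
      Real.exp (2 * t * (f s - δ)) ≤
        Real.exp (-(1 - s) * (2 * t * deriv f s)) * expect (ν m t) T +
          Real.exp (s * (2 * t * deriv f s)) * expect (ω m t) (1 - T) := by
  obtain ⟨u, hu, hr1, hr2, hf1, hf2⟩ := exists_symmetric_slope (h.differentiable s hs)
    (h.rate s hs) (show 0 < δ / 16 by positivity)
  -- The window `κ = 2t(δ/8)` gives room `2tuδ/8` in each tail condition. Half is spent on the slope
  -- error `δ/16`; the rest covers two entropy errors `2tη` and `log 4`.
  set η := min (u * (δ / 8) / 8) (δ / 8) with hη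
  have hη0 : 0 < η := by positivity
  have hη1 : η ≤ u * (δ / 8) / 8 := min_le_left _ _
  have hη2 : η ≤ δ / 8 := min_le_right _ _
  have hlog4 : 0 < Real.log 4 := Real.log_pos (by norm_num)
  filter_upwards [hr1 η hη0, hr2 η hη0, h.hasRenyiRate hs η hη0, eventually_gt_atTop 0,
    eventually_ge_atTop (Real.log 4 / δ), eventually_ge_atTop (Real.log 4 / (u * (δ / 16)))]
    with t ht1 ht2 ht3 ht0 hta htb
  rw [div_le_iff₀ (by positivity)] at hta htb
  filter_upwards [ht1, ht2, ht3] with m hm1 hm2 hm3 T hT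
  have a1 := (abs_le.1 hm1).2
  have a2 := (abs_le.1 hm2).2
  obtain ⟨a3, a4⟩ := abs_le.1 hm3
  have tη1 : t * η ≤ t * (u * (δ / 8) / 8) := mul_le_mul_of_nonneg_left hη1 ht0.le
  have tη2 : t * η ≤ t * (δ / 8) := mul_le_mul_of_nonneg_left hη2 ht0.le
  have tf1 := mul_le_mul_of_nonneg_left hf1 ht0.le
  have tf2 := mul_le_mul_of_nonneg_left hf2 ht0.le
  refine le_trans ?_ (le_error_of_renyiEntropy_le (h.posDef_left m t) (h.posDef_right m t)
    (h.trace_left m t) (κ := 2 * t * (δ / 8)) hs hu ?_ ?_ hT)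
  · rw [← Real.exp_log (show (0 : ℝ) < 1 / 4 by norm_num), ← Real.exp_add]
    refine Real.exp_le_exp.2 ?_
    rw [one_div, Real.log_inv]
    linarith
  · linarith
  · linarith

theorem eventually_le_error_one (h : IsRegularPair ν ω f) {δ ε : ℝ} (hδ : 0 < δ) (hε : 0 < ε) :
    ∀ᶠ t : ℝ in atTop, ∀ᶠ m in atTop, ∀ T, IsStarProjection T →
      1 - ε ≤ expect (ν m t) T + Real.exp (2 * t * (deriv f 1 + δ)) * expect (ω m t) (1 - T) := by
  have hs : (1 : ℝ) ∈ Set.Icc (0 : ℝ) 1 := by simp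
  obtain ⟨u, hu, hr1, hr2, hf1, hf2⟩ := exists_symmetric_slope (h.differentiable 1 hs)
    (h.rate 1 hs) (show 0 < δ / 4 by positivity)
  rw [h.apply_one] at hf1 hf2
  have hη0 : 0 < u * (δ / 8) := by positivity
  have hlim : ∀ a : ℝ, 0 < a → Tendsto (fun t : ℝ => Real.exp (-(t * a))) atTop (𝓝 0) := fun a ha =>
    Real.tendsto_exp_neg_atTop_nhds_zero.comp (tendsto_id.atTop_mul_const ha)
  filter_upwards [hr1 _ hη0, hr2 _ hη0, eventually_gt_atTop 0,
    (hlim δ hδ).eventually_lt_const (show 0 < ε / 2 by positivity),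
    (hlim (u * (δ / 4)) (by positivity)).eventually_lt_const (show 0 < ε / 4 by positivity)]
    with t ht1 ht2 ht0 hta htb
  filter_upwards [ht1, ht2] with m hm1 hm2 T hT
  have a1 := (abs_le.1 hm1).2
  have a2 := (abs_le.1 hm2).2
  have tf1 := mul_le_mul_of_nonneg_left hf1 ht0.le
  have tf2 := mul_le_mul_of_nonneg_left hf2 ht0.le
  have key := le_error_of_renyiEntropy_le_one (h.posDef_left m t) (h.posDef_right m t)
    (h.trace_left m t) (c := 2 * t * deriv f 1) (κ := t * δ) (u := u) (L := t * (u * (δ / 4)))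
    hu (by positivity) (by linarith) (by linarith) hT
  have e : 2 * t * deriv f 1 + 2 * (t * δ) = 2 * t * (deriv f 1 + δ) := by ring
  rw [e] at key
  linarith

theorem eventually_exists_test (h : IsRegularPair ν ω f) {s : ℝ} (hs : s ∈ Set.Icc (0 : ℝ) 1)
    (α : ℝ) {δ : ℝ} (hδ : 0 < δ) : ∀ᶠ t : ℝ in atTop, ∀ᶠ m in atTop, ∃ T, IsStarProjection T ∧
      expect (ν m t) T ≤ Real.exp (2 * t * ((1 - s) * α + f s + δ)) ∧
      expect (ω m t) (1 - T) ≤ Real.exp (2 * t * (-s * α + f s + δ)) := by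
  filter_upwards [h.hasRenyiRate hs δ hδ] with t ht
  filter_upwards [ht] with m hm
  have a := (abs_le.1 hm).2
  obtain ⟨T, hT, h1, h2⟩ := exists_test_weighted_le (h.posDef_left m t) (h.posDef_right m t)
    (h.trace_left m t) hs (2 * t * α)
  exact ⟨T, hT, h1.trans (Real.exp_le_exp.2 (by linarith)),
    h2.trans (Real.exp_le_exp.2 (by linarith))⟩

theorem typeI_zero (h : IsRegularPair ν ω f) (m : ℕ) (t : ℝ) :
    expect (ω m t) (1 - 0) = 1 := expect_one_sub_zero (h.trace_right m t)

/-- Tests with prescribed exponential bounds can be replaced by tests whose type-I error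
probabilities converge. -/
theorem exists_testFamily (h : IsRegularPair ν ω f) {ρ ρ₀ b : ℝ} (hρ : ρ < ρ₀)
    (hT : ∀ᶠ t : ℝ in atTop, ∀ᶠ m in atTop, ∃ T, IsStarProjection T ∧
      expect (ν m t) T ≤ Real.exp (2 * t * -ρ₀) ∧ expect (ω m t) (1 - T) ≤ Real.exp (2 * t * b)) :
    ∃ (T : MatrixFamily d) (g : ℝ → ℝ), ∃ b' ≤ b, IsTestFamily T ∧
      (∀ᶠ t : ℝ in atTop, ∀ᶠ m in atTop, typeII ν T m t ≤ Real.exp (2 * t * -ρ)) ∧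
      (∀ t, 0 < t → Tendsto (fun m => typeI ω T m t) atTop (𝓝 (g t))) ∧
      ∀ᶠ t in atTop, g t = Real.exp (2 * t * b') := by
  classical
  rcases le_or_gt 0 b with hb | hb
  -- For `b ≥ 0` the zero test suffices: its type-I error is `1`, of rate `0 ≤ b`, and its type-II
  -- error vanishes.
  · refine ⟨fun _ _ => 0, fun _ => 1, 0, hb, fun _ _ _ => .zero _, ?_, fun t _ => ?_, ?_⟩
    · refine Eventually.of_forall fun t => Eventually.of_forall fun m => ?_
      rw [typeII, expect_zero]
      exact (Real.exp_pos _).le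
    · simp only [typeI, h.typeI_zero]
      exact tendsto_const_nhds
    · simp
  obtain ⟨t₀, ht₀⟩ := eventually_atTop.1 (hT.and (eventually_gt_atTop 0))
  set n : ℕ → ℕ := fun m => d m / 2 with hn
  have hn_top : Tendsto n atTop atTop :=
    (Nat.tendsto_div_const_atTop (by norm_num)).comp h.dim
  let P : (m : ℕ) → (t : ℝ) → Matrix (Fin (d m)) (Fin (d m)) ℂ → Prop := fun m t T =>
    IsStarProjection T ∧ |expect (ω m t) (1 - T) - Real.exp (2 * t * b)| ≤ 2 / n m ∧
      expect (ν m t) T ≤ 2 * Real.exp (2 * t * -ρ₀) + 4 / n m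
  have hP : ∀ t, t₀ ≤ t → ∀ᶠ m in atTop, ∃ T, P m t T := fun t ht => by
    filter_upwards [(ht₀ t ht).1, hn_top.eventually_gt_atTop 0] with m hm hnm
    obtain ⟨T, hTp, h1, h2⟩ := hm
    have hx : Real.exp (2 * t * b) ≤ 1 := by
      have := (ht₀ t ht).2
      exact Real.exp_le_one_iff.2 (by nlinarith)
    obtain ⟨T', hT', h3, h4⟩ := exists_test_approx (h.posDef_left m t).posSemidef
      (h.posDef_right m t).posSemidef (h.trace_left m t) (h.trace_right m t) hTp hx h2 hnm
      (Nat.mul_div_le _ _)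
    exact ⟨T', hT', h3, h4.trans (by linarith)⟩
  -- The limit in `m` must exist for every `t > 0`. Before `t₀`, and for those `m` where no good
  -- test exists, the zero test is the default; for each fixed `t ≥ t₀` only finitely many `m` are
  -- affected.
  set T : MatrixFamily d := fun m t =>
    if hT : t₀ ≤ t ∧ ∃ T, P m t T then hT.2.choose else 0 with hTdef
  have hTP : ∀ t, t₀ ≤ t → ∀ᶠ m in atTop, P m t (T m t) := fun t ht => by
    filter_upwards [hP t ht] with m hm
    have hT' : t₀ ≤ t ∧ ∃ T, P m t T := ⟨ht, hm⟩
    simp only [hTdef, dif_pos hT']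
    exact hT'.2.choose_spec
  have hlim : ∀ c : ℝ, Tendsto (fun m => c / (n m : ℝ)) atTop (𝓝 0) := fun c =>
    (tendsto_const_nhds.div_atTop tendsto_natCast_atTop_atTop).comp hn_top
  refine ⟨T, fun t => if t₀ ≤ t then Real.exp (2 * t * b) else 1, b, le_rfl, ?_, ?_, ?_, ?_⟩
  · intro m t _
    simp only [hTdef]
    split_ifs with hT'
    · exact hT'.2.choose_spec.1
    · exact .zero _
  · have hdec : Tendsto (fun t : ℝ => Real.exp (-(t * (2 * (ρ₀ - ρ))))) atTop (𝓝 0) :=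
      Real.tendsto_exp_neg_atTop_nhds_zero.comp
        (tendsto_id.atTop_mul_const (by linarith))
    filter_upwards [eventually_ge_atTop t₀,
      hdec.eventually_lt_const (show (0 : ℝ) < 1 / 3 by norm_num)] with t ht hdt
    filter_upwards [hTP t ht, (hlim 4).eventually_lt_const (Real.exp_pos (2 * t * -ρ₀))]
      with m hm hnm
    have e : Real.exp (2 * t * -ρ₀) =
        Real.exp (2 * t * -ρ) * Real.exp (-(t * (2 * (ρ₀ - ρ)))) := by
      rw [← Real.exp_add]; ring_nf
    have := hm.2.2
    rw [typeII]
    have p := Real.exp_pos (2 * t * -ρ)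
    nlinarith
  · intro t ht
    simp only
    split_ifs with htt
    · rw [tendsto_iff_norm_sub_tendsto_zero]
      refine squeeze_zero' (Eventually.of_forall fun _ => norm_nonneg _) ?_ (hlim 2)
      filter_upwards [hTP t htt] with m hm using hm.2.1
    · have : ∀ m, T m t = 0 := fun m => by
        simp only [hTdef]; rw [dif_neg (fun hh => htt hh.1)]
      simp only [typeI, this, h.typeI_zero]
      exact tendsto_const_nhds
  · filter_upwards [eventually_ge_atTop t₀] with t ht
    rw [if_pos ht]

end IsRegularPair

end

/-! ### The three error exponents of a regular pair. -/

section

variable {d : ℕ → ℕ} {ν ω : MatrixFamily d} {f : ℝ → ℝ}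

theorem bddBelow_error {d : ℕ} {ν ω : Matrix (Fin d) (Fin d) ℂ} (hν : ν.PosDef) (hω : ω.PosDef) :
    BddBelow (Set.range fun T : {T : Matrix (Fin d) (Fin d) ℂ // IsStarProjection T} =>
      (expect ν T.1 + expect ω (1 - T.1))) := by
  refine ⟨0, ?_⟩
  rintro _ ⟨T, rfl⟩
  exact add_nonneg (expect_nonneg hν.posSemidef T.2) (expect_nonneg hω.posSemidef T.2.one_sub)

theorem minError_le {d : ℕ} {ν ω : Matrix (Fin d) (Fin d) ℂ} (hν : ν.PosDef) (hω : ω.PosDef)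
    (hν1 : ν.trace = 1) {s : ℝ} (hs : s ∈ Set.Icc (0 : ℝ) 1) :
    minError ν ω ≤ Real.exp (renyiEntropy ν ω s) := by
  obtain ⟨T, hT, h⟩ := exists_test_le_trace_rpow hν.posSemidef hω.posSemidef hs
  rw [exp_renyiEntropy hν hω hν1]
  exact (ciInf_le (bddBelow_error hν hω) ⟨T, hT⟩).trans h

theorem le_minError {d : ℕ} {ν ω : Matrix (Fin d) (Fin d) ℂ} {c : ℝ}
    (h : ∀ T, IsStarProjection T → c ≤ expect ν T + expect ω (1 - T)) : c ≤ minError ν ω := by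
  have : Nonempty {T : Matrix (Fin d) (Fin d) ℂ // IsStarProjection T} := ⟨⟨0, .zero _⟩⟩
  exact le_ciInf fun T => h T.1 T.2

theorem le_hoeffdingFunction_neg {r : ℝ} {s : ℝ} (hs : s ∈ Set.Ico (0 : ℝ) 1) :
    hoeffdingFunction f r ≤ ((-((-s * r - f s) / (1 - s)) : ℝ) : EReal) := by
  rw [hoeffdingFunction, EReal.coe_neg, EReal.neg_le_neg_iff]
  exact le_iSup₂ (f := fun s (_ : s ∈ Set.Ico (0 : ℝ) 1) =>
    (((-s * r - f s) / (1 - s) : ℝ) : EReal)) s hs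

namespace IsRegularPair

theorem chernoff (h : IsRegularPair ν ω f) (h0 : deriv f 0 < 0) (h1 : 0 < deriv f 1) :
    chernoffLower ν ω = ⨅ s ∈ Set.Icc (0 : ℝ) 1, (f s : EReal) ∧
    chernoffUpper ν ω = ⨅ s ∈ Set.Icc (0 : ℝ) 1, (f s : EReal) := by
  have hle : chernoffLower ν ω ≤ chernoffUpper ν ω := lowerRate_le_upperRate _
  have hup : chernoffUpper ν ω ≤ ⨅ s ∈ Set.Icc (0 : ℝ) 1, (f s : EReal) := by
    refine le_iInf₂ fun s hs => upperRate_le fun δ hδ => ?_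
    filter_upwards [h.hasRenyiRate hs δ hδ] with t ht
    filter_upwards [ht] with m hm
    refine (minError_le (h.posDef_left m t) (h.posDef_right m t) (h.trace_left m t) hs).trans
      (Real.exp_le_exp.2 ?_)
    linarith [(abs_le.1 hm).2]
  have hlow : ⨅ s ∈ Set.Icc (0 : ℝ) 1, (f s : EReal) ≤ chernoffLower ν ω := by
    obtain ⟨s, hs, hmin⟩ := isCompact_Icc.exists_isMinOn (Set.nonempty_Icc.2 zero_le_one)
      h.continuousOn
    have hs0 : s ≠ 0 := by
      rintro rfl
      obtain ⟨u, hu, hu1, -, hfu, -⟩ := exists_symmetric_slope (h.differentiable 0 hs)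
        (eventually_lt_nhds zero_lt_one) (show 0 < -deriv f 0 / 2 by linarith)
      have := isMinOn_iff.1 hmin (0 + u) ⟨by linarith, hu1.le⟩
      nlinarith
    have hs1 : s ≠ 1 := by
      rintro rfl
      obtain ⟨u, hu, -, hu1, -, hfu⟩ := exists_symmetric_slope (h.differentiable 1 hs)
        (eventually_gt_nhds zero_lt_one) (show 0 < deriv f 1 / 2 by linarith)
      have := isMinOn_iff.1 hmin (1 - u) ⟨hu1.le, by linarith⟩
      nlinarith
    -- The signs of the end slopes put the minimum inside the interval. At zero slope both weights
    -- in `eventually_le_error` equal `1`, which is the unweighted error.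
    have hd : deriv f s = 0 := by
      refine IsLocalMin.deriv_eq_zero (hmin.isLocalMin (Icc_mem_nhds ?_ ?_))
      · exact lt_of_le_of_ne hs.1 hs0.symm
      · exact lt_of_le_of_ne hs.2 hs1
    refine (iInf₂_le s hs).trans (le_lowerRate fun δ hδ => ?_)
    filter_upwards [h.eventually_le_error hs hδ] with t ht
    filter_upwards [ht] with m hm
    refine le_minError fun T hT => ?_
    have := hm T hT
    simpa [hd] using this
  exact ⟨le_antisymm (hle.trans hup) hlow, le_antisymm hup (hlow.trans hle)⟩

/-- Tangent lines of the rate function bound the type-I rate from below. -/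
theorem tangent_le_lowerRate (h : IsRegularPair ν ω f) {T : MatrixFamily d} (hT : IsTestFamily T)
    {r s : ℝ} (hr : upperRate (typeII ν T) < ((-r : ℝ) : EReal)) (hs : s ∈ Set.Icc (0 : ℝ) 1)
    (htan : -r ≤ f s + (1 - s) * deriv f s) :
    ((f s - s * deriv f s : ℝ) : EReal) ≤ lowerRate (typeI ω T) := by
  obtain ⟨c', hc', hII⟩ := exists_le_exp_of_upperRate_lt hr
  refine le_lowerRate fun δ hδ => ?_
  -- The strict gap between the type-II rate and `-r` makes the type-II term negligible: by `htan`
  -- it is exponentially smaller than the lower bound `D`, so the type-I term carries at least `D /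
  -- 2`.
  set δ' := min (δ / 2) ((-r - c') / 2) with hδ'
  have hgap : 0 < -r - c' := by linarith
  have hδ'0 : 0 < δ' := by positivity
  have hδ1 : δ' ≤ δ / 2 := min_le_left _ _
  have hδ2 : δ' ≤ (-r - c') / 2 := min_le_right _ _
  have hlim : ∀ a : ℝ, 0 < a → Tendsto (fun t : ℝ => Real.exp (-(t * a))) atTop (𝓝 0) := fun a ha =>
    Real.tendsto_exp_neg_atTop_nhds_zero.comp (tendsto_id.atTop_mul_const ha)
  filter_upwards [hII, h.eventually_le_error hs hδ'0, eventually_gt_atTop 0,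
    (hlim _ hgap).eventually_lt_const (show (0 : ℝ) < 1 / 2 by norm_num),
    (hlim _ hδ).eventually_lt_const (show (0 : ℝ) < 1 / 2 by norm_num)]
    with t ht1 ht2 ht0 hta htb
  filter_upwards [ht1, ht2] with m hm1 hm2
  have key := hm2 (T m t) (hT m t ht0)
  rw [typeII] at hm1
  rw [typeI]
  set D := Real.exp (2 * t * (f s - δ')) with hD
  have hDpos : 0 < D := Real.exp_pos _
  have i1 : Real.exp (-(1 - s) * (2 * t * deriv f s)) * expect (ν m t) (T m t) ≤
      D * Real.exp (-(t * (-r - c'))) := by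
    refine (mul_le_mul_of_nonneg_left hm1 (Real.exp_pos _).le).trans ?_
    rw [hD, ← Real.exp_add, ← Real.exp_add]
    refine Real.exp_le_exp.2 ?_
    have := mul_le_mul_of_nonneg_left htan ht0.le
    have := mul_le_mul_of_nonneg_left hδ2 ht0.le
    linarith
  have i2 : D / 2 ≤ Real.exp (s * (2 * t * deriv f s)) * expect (ω m t) (1 - T m t) := by
    nlinarith
  have i3 : Real.exp (s * (2 * t * deriv f s)) * Real.exp (2 * t * (f s - s * deriv f s - δ)) ≤
      D * Real.exp (-(t * δ)) := by
    rw [hD, ← Real.exp_add, ← Real.exp_add]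
    refine Real.exp_le_exp.2 ?_
    have := mul_le_mul_of_nonneg_left hδ1 ht0.le
    linarith
  refine le_of_mul_le_mul_left (a := Real.exp (s * (2 * t * deriv f s))) ?_ (Real.exp_pos _)
  nlinarith

theorem hoeffdingFunction_zero_le (h : IsRegularPair ν ω f) :
    hoeffdingFunction f 0 ≤ ((-deriv f 1 : ℝ) : EReal) := by
  refine EReal.le_of_forall_lt_iff_le.1 fun z hz => ?_
  have hz' : -deriv f 1 < z := by exact_mod_cast hz
  obtain ⟨u, hu, -, hu1, -, hfu⟩ := exists_symmetric_slope (h.differentiable 1 (by simp))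
    (eventually_gt_nhds zero_lt_one) (show 0 < z + deriv f 1 by linarith)
  refine (le_hoeffdingFunction_neg (s := 1 - u) ⟨hu1.le, by linarith⟩).trans ?_
  rw [EReal.coe_le_coe_iff, mul_zero, sub_sub_cancel, zero_sub, neg_div, neg_neg,
    div_le_iff₀ hu]
  rw [h.apply_one] at hfu
  linarith

/-- As `s → 1` the numerator `-s r - f s` tends to `-r > 0` while the denominator tends to `0`, so
the supremum is infinite. -/
theorem hoeffdingFunction_of_neg (h : IsRegularPair ν ω f) {r : ℝ} (hr : r < 0) :
    hoeffdingFunction f r = ⊥ := by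
  refine le_bot_iff.1 (EReal.le_of_forall_lt_iff_le.1 fun z _ => ?_)
  obtain ⟨u, hu, -, hu1, -, hfu⟩ := exists_symmetric_slope
    (P := fun v => 1 / 2 < v ∧ 1 - v < -r / (2 * (|z| + |deriv f 1| + 2)))
    (h.differentiable 1 (by simp)) ((eventually_gt_nhds one_half_lt_one).and (by
      have hc : Tendsto (fun v : ℝ => 1 - v) (𝓝 1) (𝓝 (1 - 1)) :=
        (continuous_const.sub continuous_id).tendsto 1
      refine hc.eventually_lt_const ?_
      rw [sub_self]
      have : 0 < -r := by linarith
      positivity)) zero_lt_one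
  obtain ⟨hu1, hu2⟩ := hu1
  refine (le_hoeffdingFunction_neg (s := 1 - u) ⟨by linarith, by linarith⟩).trans ?_
  rw [h.apply_one] at hfu
  rw [EReal.coe_le_coe_iff, sub_sub_cancel, ← neg_div, div_le_iff₀ hu]
  rw [sub_sub_cancel, lt_div_iff₀ (by positivity)] at hu2
  have a1 := mul_le_mul_of_nonneg_left (neg_abs_le z) hu.le
  have a2 := mul_le_mul_of_nonneg_left (neg_abs_le (deriv f 1)) hu.le
  have a3 := mul_nonneg hu.le (abs_nonneg z)
  have a4 := mul_nonneg hu.le (abs_nonneg (deriv f 1))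
  have a5 := mul_pos (show 0 < 1 / 2 - u by linarith) (show 0 < -r by linarith)
  linarith

/-- For `r > 0` the supremum `H` is attained at some `s < 1`. The line with values `-H` at `0` and
`-r` at `1` lies below `f` and touches it at `s`, so it is a tangent when `s > 0`; when `s = 0` only
one inequality between the slopes survives, and it suffices. The case `r = 0` uses the tangent at
`1`. -/
theorem hoeffdingFunction_le_lowerRate (h : IsRegularPair ν ω f) {T : MatrixFamily d}
    (hT : IsTestFamily T) {r : ℝ} (hr : upperRate (typeII ν T) < ((-r : ℝ) : EReal)) :
    hoeffdingFunction f r ≤ lowerRate (typeI ω T) := by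
  rcases lt_trichotomy r 0 with hr0 | rfl | hr0
  · rw [h.hoeffdingFunction_of_neg hr0]
    exact bot_le
  · have := h.tangent_le_lowerRate hT hr (s := 1) (by simp) (by simp [h.apply_one])
    rw [h.apply_one, one_mul, zero_sub] at this
    exact h.hoeffdingFunction_zero_le.trans this
  set g : ℝ → ℝ := fun s => (-s * r - f s) / (1 - s) with hg
  have hg0 : g 0 = 0 := by simp [hg, h.apply_zero]
  have hnum : ∀ᶠ v in 𝓝 (1 : ℝ), -v * r - f v < 0 := by
    have hc : ContinuousAt (fun v : ℝ => -v * r - f v) 1 :=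
      (by fun_prop : ContinuousAt (fun v : ℝ => -v * r) 1).sub
        (h.differentiable 1 (by simp)).continuousAt
    refine hc.eventually_lt_const ?_
    simp only [h.apply_one]
    linarith
  obtain ⟨ε, hε, hball⟩ := Metric.eventually_nhds_iff.1 hnum
  have hneg : ∀ v, 1 - ε < v → v < 1 → g v < 0 := fun v hv hv1 =>
    div_neg_of_neg_of_pos (hball (by rw [Real.dist_eq, abs_lt]; constructor <;> linarith))
      (by linarith)
  -- Near `1` the quotient `g` is negative, whereas `g 0 = 0`; a maximum over `[0, a]` is therefore
  -- one over `[0, 1)`.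
  set a := max (1 - ε / 2) 0 with ha
  have ha1 : a < 1 := max_lt (by linarith) zero_lt_one
  have ha0 : 0 ≤ a := le_max_right _ _
  have hcont : ContinuousOn g (Set.Icc 0 a) := by
    refine ContinuousOn.div (ContinuousOn.sub (by fun_prop)
      (h.continuousOn.mono (Set.Icc_subset_Icc_right ha1.le))) (by fun_prop) fun v hv => ?_
    linarith [hv.2]
  obtain ⟨s, hs, hmax⟩ := isCompact_Icc.exists_isMaxOn (Set.nonempty_Icc.2 ha0) hcont
  have hs1 : s < 1 := hs.2.trans_lt ha1
  have hmax' : ∀ v ∈ Set.Ico (0 : ℝ) 1, g v ≤ g s := fun v hv => by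
    rcases le_or_gt v a with hva | hva
    · exact isMaxOn_iff.1 hmax v ⟨hv.1, hva⟩
    · have h1 := hneg v (by linarith [le_max_left (1 - ε / 2) 0]) hv.2
      have h2 := isMaxOn_iff.1 hmax 0 ⟨le_rfl, ha0⟩
      linarith
  have hsI : s ∈ Set.Icc (0 : ℝ) 1 := ⟨hs.1, hs1.le⟩
  set H := g s with hH
  have hline : ∀ v ∈ Set.Ico (0 : ℝ) 1, -v * r - H * (1 - v) ≤ f v := fun v hv => by
    have := hmax' v hv
    rw [hg] at this
    simp only at this
    rw [div_le_iff₀ (by linarith [hv.2])] at this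
    linarith
  have hfs : f s = -s * r - H * (1 - s) := by
    rw [hH, hg]
    simp only
    rw [div_mul_cancel₀ _ (by linarith)]
    ring
  have hd1 : H - r ≤ deriv f s := by
    refine le_of_forall_pos_le_add fun δ hδ => ?_
    obtain ⟨u, hu, hu1, -, hfu, -⟩ := exists_symmetric_slope (h.differentiable s hsI)
      (eventually_lt_nhds hs1) hδ
    have := hline (s + u) ⟨by linarith [hs.1], hu1⟩
    have h3 : u * (H - r) ≤ u * (deriv f s + δ) := by linarith
    exact le_of_mul_le_mul_left h3 hu
  have hd2 : s * deriv f s ≤ s * (H - r) := by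
    rcases hs.1.eq_or_lt with h0 | h0
    · simp [← h0]
    refine mul_le_mul_of_nonneg_left (le_of_forall_pos_le_add fun δ hδ => ?_) hs.1
    obtain ⟨u, hu, -, hu1, -, hfu⟩ := exists_symmetric_slope (h.differentiable s hsI)
      (eventually_gt_nhds h0) hδ
    have := hline (s - u) ⟨hu1.le, by linarith⟩
    have h3 : u * deriv f s ≤ u * (H - r + δ) := by linarith
    exact le_of_mul_le_mul_left h3 hu
  have htan := h.tangent_le_lowerRate hT hr hsI (by nlinarith)
  refine (le_hoeffdingFunction_neg (s := s) ⟨hs.1, hs1⟩).trans (le_trans ?_ htan)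
  rw [EReal.coe_le_coe_iff]
  change -H ≤ _
  linarith

theorem exists_testFamily_of_hoeffdingFunction_lt (h : IsRegularPair ν ω f) {r c' : ℝ}
    (hc : hoeffdingFunction f r < c') :
    ∃ (T : MatrixFamily d) (g : ℝ → ℝ), ∃ b ≤ c', ∃ ρ > r, IsTestFamily T ∧
      (∀ᶠ t : ℝ in atTop, ∀ᶠ m in atTop, typeII ν T m t ≤ Real.exp (2 * t * -ρ)) ∧
      (∀ t, 0 < t → Tendsto (fun m => typeI ω T m t) atTop (𝓝 (g t))) ∧
      ∀ᶠ t in atTop, g t = Real.exp (2 * t * b) := by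
  rw [hoeffdingFunction, EReal.neg_lt_comm, ← EReal.coe_neg] at hc
  simp only [lt_iSup_iff] at hc
  obtain ⟨s, hs, hlt⟩ := hc
  rw [EReal.coe_lt_coe_iff, lt_div_iff₀ (by linarith [hs.2])] at hlt
  have h1s : 0 < 1 - s := by linarith [hs.2]
  -- A quarter of the slack. The choice of `α` makes the type-II exponent exactly `-(r + ε)`, and
  -- the type-I exponent then costs at most `2ε` of the slack after multiplication by `1 - s`.
  set ε := (c' * (1 - s) - (s * r + f s)) / 4 with hε
  have hε0 : 0 < ε := by rw [hε]; linarith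
  set α := (-(r + 2 * ε) - f s) / (1 - s) with hα
  have hα' : (1 - s) * α = -(r + 2 * ε) - f s := by rw [hα]; field_simp
  have hb : -s * α + f s + ε ≤ c' := by
    refine le_of_mul_le_mul_right ?_ h1s
    have e : (-s * α + f s + ε) * (1 - s) = -s * ((1 - s) * α) + (f s + ε) * (1 - s) := by ring
    rw [e, hα']
    have := mul_le_mul_of_nonneg_left hs.2.le hε0.le
    linarith
  obtain ⟨T, g, b, hbb, hT, hII, hI, hg⟩ := h.exists_testFamily (ρ := r + ε / 2) (ρ₀ := r + ε)
    (b := -s * α + f s + ε) (by linarith) (by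
      filter_upwards [h.eventually_exists_test ⟨hs.1, hs.2.le⟩ α hε0] with t ht
      filter_upwards [ht] with m hm
      obtain ⟨T, hT, h1, h2⟩ := hm
      refine ⟨T, hT, h1.trans (le_of_eq ?_), h2⟩
      rw [hα']
      congr 1
      ring)
  exact ⟨T, g, b, hbb.trans hb, r + ε / 2, by linarith, hT, hII, hI, hg⟩

theorem hoeffding (h : IsRegularPair ν ω f) (r : ℝ) :
    hoeffdingLower ν ω r = hoeffdingFunction f r ∧
    hoeffdingUpper ν ω r = hoeffdingFunction f r ∧
    ArrowOfTime.hoeffding ν ω r = hoeffdingFunction f r := by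
  have := sInf_rates_eq (β := MatrixFamily d) (x := fun T => typeI ω T)
    (C := fun T => IsTestFamily T ∧ upperRate (typeII ν T) < ((-r : ℝ) : EReal))
    (c := hoeffdingFunction f r)
    (fun T hT => h.hoeffdingFunction_le_lowerRate hT.1 hT.2) fun c' hc' => by
      obtain ⟨T, g, b, hb, ρ, hρ, hT, hII, hI, hg⟩ :=
        h.exists_testFamily_of_hoeffdingFunction_lt hc'
      refine ⟨T, ⟨hT, ?_⟩, b, hb, hasRate_of_tendsto hI hg⟩
      refine lt_of_le_of_lt (b := ((-ρ : ℝ) : EReal)) (upperRate_le fun δ hδ => ?_)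
        (EReal.coe_lt_coe_iff.2 (by linarith))
      filter_upwards [hII, eventually_gt_atTop 0] with t ht ht0
      filter_upwards [ht] with m hm
      exact hm.trans (Real.exp_le_exp.2 (by nlinarith))
  simpa only [and_assoc, hoeffdingLower, hoeffdingUpper, ArrowOfTime.hoeffding] using this

theorem stein (h : IsRegularPair ν ω f) {ε : ℝ} (hε : 0 < ε) (hε1 : ε < 1) :
    steinLower ν ω ε = ((-deriv f 1 : ℝ) : EReal) ∧
    steinUpper ν ω ε = ((-deriv f 1 : ℝ) : EReal) ∧
    ArrowOfTime.stein ν ω ε = ((-deriv f 1 : ℝ) : EReal) := by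
  classical
  have := sInf_rates_eq (β := MatrixFamily d) (x := fun T => typeI ω T)
    (C := fun T => IsTestFamily T ∧ ∀ (m : ℕ) (t : ℝ), 0 < t → typeII ν T m t ≤ ε)
    (c := ((-deriv f 1 : ℝ) : EReal)) (fun T hT => by
      refine le_lowerRate fun δ hδ => ?_
      have hgap : 0 < (1 - ε) / 2 := by linarith
      have hlim : Tendsto (fun t : ℝ => Real.exp (-(t * δ))) atTop (𝓝 0) :=
        Real.tendsto_exp_neg_atTop_nhds_zero.comp (tendsto_id.atTop_mul_const hδ)
      filter_upwards [h.eventually_le_error_one (half_pos hδ) hgap, eventually_gt_atTop 0,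
        hlim.eventually_lt_const hgap] with t ht ht0 htδ
      filter_upwards [ht] with m hm
      have h1 := hm (T m t) (hT.1 m t ht0)
      have h2 := hT.2 m t ht0
      rw [typeII] at h2
      rw [typeI]
      refine le_of_mul_le_mul_left (a := Real.exp (2 * t * (deriv f 1 + δ / 2))) ?_
        (Real.exp_pos _)
      rw [← Real.exp_add]
      have e : 2 * t * (deriv f 1 + δ / 2) + 2 * t * (-deriv f 1 - δ) = -(t * δ) := by ring
      rw [e]
      linarith) fun c' hc' => by
      obtain ⟨T, g, b, hb, ρ, hρ, hT, hII, hI, hg⟩ :=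
        -- Hoeffding tests at `r = 0` have type-II errors decaying at a rate `ρ > 0`, hence
        -- eventually below any `ε`.
        h.exists_testFamily_of_hoeffdingFunction_lt (h.hoeffdingFunction_zero_le.trans_lt hc')
      have hdec : Tendsto (fun t : ℝ => Real.exp (-(t * (2 * ρ)))) atTop (𝓝 0) :=
        Real.tendsto_exp_neg_atTop_nhds_zero.comp (tendsto_id.atTop_mul_const (by linarith))
      obtain ⟨t₀, ht₀⟩ := eventually_atTop.1 (hII.and (hdec.eventually_lt_const hε))
      have hev : ∀ t, t₀ ≤ t → ∀ᶠ m in atTop, typeII ν T m t ≤ ε := fun t ht => by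
        filter_upwards [(ht₀ t ht).1] with m hm
        refine hm.trans (le_trans (le_of_eq ?_) (ht₀ t ht).2.le)
        congr 1
        ring
      -- The Stein constraint is required for all `m` and `t`, not only eventually. Where it fails,
      -- and before `t₀`, the zero test is substituted; this leaves the limits in `m` for `t ≥ t₀`
      -- unchanged.
      set T' : MatrixFamily d := fun m t => if t₀ ≤ t ∧ typeII ν T m t ≤ ε then T m t else 0
        with hT'
      refine ⟨T', ⟨fun m t ht => ?_, fun m t ht => ?_⟩, b, hb,
        hasRate_of_tendsto (g := fun t => if t₀ ≤ t then g t else 1) (fun t ht => ?_) ?_⟩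
      · simp only [hT']
        split_ifs
        · exact hT m t ht
        · exact .zero _
      · rw [typeII]
        simp only [hT']
        split_ifs with hc
        · exact hc.2
        · rw [expect_zero]
          exact hε.le
      · split_ifs with htt
        · refine (hI t ht).congr' ?_
          filter_upwards [hev t htt] with m hm
          rw [typeI, typeI]
          simp only [hT', if_pos (show t₀ ≤ t ∧ typeII ν T m t ≤ ε from ⟨htt, hm⟩)]
        · have : ∀ m, T' m t = 0 := fun m => by
            simp only [hT']; rw [if_neg (fun hh => htt hh.1)]
          simp only [typeI, this, h.typeI_zero]
          exact tendsto_const_nhds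
      · filter_upwards [hg, eventually_ge_atTop t₀] with t ht htt
        rw [if_pos htt, ht]
  simpa only [and_assoc, steinLower, steinUpper, ArrowOfTime.stein] using this

end IsRegularPair

end

/-! ### Entropy production, and regularity of the forward and backward states. -/

section

section Laplace

variable {ι : Type*} [Fintype ι] {w y : ι → ℝ}

theorem exp_mul_sum_le (hw : ∀ k, 0 ≤ w k) (hw1 : ∑ k, w k = 1) (h : ℝ) :
    Real.exp (h * ∑ k, w k * y k) ≤ ∑ k, w k * Real.exp (h * y k) := by
  set c := h * ∑ k, w k * y k with hc
  have h1 : ∀ k ∈ Finset.univ, w k * (Real.exp c * (1 + (h * y k - c))) ≤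
      w k * Real.exp (h * y k) := fun k _ => by
    refine mul_le_mul_of_nonneg_left ?_ (hw k)
    have e : Real.exp (h * y k) = Real.exp c * Real.exp (h * y k - c) := by
      rw [← Real.exp_add]; ring_nf
    rw [e]
    refine mul_le_mul_of_nonneg_left ?_ (Real.exp_pos c).le
    linarith [Real.add_one_le_exp (h * y k - c)]
  refine le_trans (le_of_eq ?_) (Finset.sum_le_sum h1)
  have e : ∀ k, w k * (Real.exp c * (1 + (h * y k - c))) =
      Real.exp c * (1 - c) * w k + Real.exp c * h * (w k * y k) := fun k => by ring
  simp only [e]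
  rw [Finset.sum_add_distrib, ← Finset.mul_sum, ← Finset.mul_sum, hw1, mul_assoc _ h, ← hc]
  ring

/-- A second-order Taylor bound whose error is integrable against exponential moments of order `±δ`.
The constant `8` comes from `z² / 2 ≤ e^z` at `z = δ|y| / 2`. -/
theorem abs_exp_sub_one_sub_le {δ h y : ℝ} (hδ : 0 < δ) (hh : |h| ≤ δ / 2) :
    |Real.exp (h * y) - 1 - h * y| ≤
      h ^ 2 * (8 / δ ^ 2 * (Real.exp (δ * y) + Real.exp (-δ * y))) := by
  have h1 : |Real.exp (h * y) - 1 - h * y| ≤ |h * y| ^ 2 * Real.exp |h * y| := by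
    have := Complex.norm_exp_sub_sum_le_norm_mul_exp ((h * y : ℝ) : ℂ) 2
    rw [Complex.norm_real, Real.norm_eq_abs] at this
    refine le_trans (le_of_eq ?_) this
    rw [← Real.norm_eq_abs, ← Complex.norm_real]
    congr 1
    simp [Finset.sum_range_succ, sub_sub]
  refine h1.trans ?_
  set z := δ / 2 * |y| with hz
  have hz0 : 0 ≤ z := by positivity
  have h2 : |h * y| ≤ z := by
    rw [abs_mul]; exact mul_le_mul_of_nonneg_right hh (abs_nonneg y)
  have h3 : z ^ 2 / 2 ≤ Real.exp z := by
    have := Real.quadratic_le_exp_of_nonneg hz0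
    linarith
  have h4 : Real.exp z * Real.exp z ≤ Real.exp (δ * y) + Real.exp (-δ * y) := by
    rw [← Real.exp_add]
    have e : z + z = δ * |y| := by rw [hz]; ring
    rw [e]
    rcases abs_choice y with hy | hy
    · rw [hy]; linarith [Real.exp_pos (-δ * y)]
    · rw [hy, mul_neg, ← neg_mul]; linarith [Real.exp_pos (δ * y)]
  have h5 : |h * y| ^ 2 = h ^ 2 * (8 / δ ^ 2 * (z ^ 2 / 2)) := by
    rw [sq_abs, mul_pow, hz, mul_pow, sq_abs]
    field_simp
    ring
  rw [h5, mul_assoc, mul_assoc]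
  refine mul_le_mul_of_nonneg_left (mul_le_mul_of_nonneg_left ?_ (by positivity)) (sq_nonneg h)
  exact (mul_le_mul h3 (Real.exp_le_exp.2 h2) (Real.exp_pos _).le (Real.exp_pos _).le).trans h4

theorem abs_sum_exp_sub_le (hw : ∀ k, 0 ≤ w k) (hw1 : ∑ k, w k = 1) {δ h : ℝ} (hδ : 0 < δ)
    (hh : |h| ≤ δ / 2) :
    |∑ k, w k * Real.exp (h * y k) - 1 - h * ∑ k, w k * y k| ≤
      h ^ 2 * (8 / δ ^ 2 * (∑ k, w k * Real.exp (δ * y k) + ∑ k, w k * Real.exp (-δ * y k))) := by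
  have e : ∑ k, w k * Real.exp (h * y k) - 1 - h * ∑ k, w k * y k =
      ∑ k, w k * (Real.exp (h * y k) - 1 - h * y k) := by
    nth_rewrite 1 [← hw1]
    rw [Finset.mul_sum, ← Finset.sum_sub_distrib, ← Finset.sum_sub_distrib]
    exact Finset.sum_congr rfl fun k _ => by ring
  rw [e, ← Finset.sum_add_distrib, Finset.mul_sum, Finset.mul_sum]
  refine (Finset.abs_sum_le_sum_abs _ _).trans (Finset.sum_le_sum fun k _ => ?_)
  rw [abs_mul, abs_of_nonneg (hw k)]
  refine (mul_le_mul_of_nonneg_left (abs_exp_sub_one_sub_le hδ hh) (hw k)).trans (le_of_eq ?_)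
  ring

end Laplace

/-- Sequences with uniformly controlled convergent difference quotients converge. -/
theorem exists_tendsto_of_quotient {A B : ℕ → ℝ} {q : ℝ → ℕ → ℝ} {δ b : ℝ} (hδ : 0 < δ)
    (hB : Tendsto B atTop (𝓝 b))
    (hq : ∀ h, 0 < h → h ≤ δ → ∃ l, Tendsto (q h) atTop (𝓝 l))
    (hA : ∀ h, 0 < h → h ≤ δ → ∀ m, |q h m - A m| ≤ h * B m) :
    ∃ a, Tendsto A atTop (𝓝 a) := by
  refine cauchySeq_tendsto_of_complete (Metric.cauchySeq_iff'.2 fun ε hε => ?_)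
  set h := min δ (ε / (4 * (|b| + 1))) with hh
  have hpos : 0 < h := by positivity
  have hhε : h * (|b| + 1) ≤ ε / 4 := by
    have : h ≤ ε / (4 * (|b| + 1)) := min_le_right _ _
    rw [le_div_iff₀ (by positivity)] at this
    linarith
  obtain ⟨l, hl⟩ := hq h hpos (min_le_left _ _)
  have hev : ∀ᶠ m in atTop, |q h m - l| < ε / 4 ∧ B m < |b| + 1 :=
    ((Metric.tendsto_nhds.1 hl (ε / 4) (by positivity)).and
      (hB.eventually_lt_const (by linarith [le_abs_self b])))
  obtain ⟨N, hN⟩ := eventually_atTop.1 hev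
  refine ⟨N, fun n hn => ?_⟩
  rw [Real.dist_eq]
  have key : ∀ m, N ≤ m → |q h m - A m| ≤ ε / 4 := fun m hm =>
    (hA h hpos (min_le_left _ _) m).trans
      ((mul_le_mul_of_nonneg_left (hN m hm).2.le hpos.le).trans hhε)
  have a1 := abs_le.1 (key n hn)
  have a2 := abs_le.1 (key N le_rfl)
  have a3 := abs_lt.1 (hN n hn).1
  have a4 := abs_lt.1 (hN N le_rfl).1
  rw [abs_lt]
  constructor <;> linarith [a1.1, a1.2, a2.1, a2.2, a3.1, a3.2, a4.1, a4.2]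

namespace FiniteQuantumSystem

/-- The expected entropy production rate is the relative entropy of `ω_t` with respect to `ω`
divided by `t`, that is, the mean of the modular law whose exponential moments are the Rényi
entropies. -/
theorem exists_entropyProduction_law (Q : FiniteQuantumSystem) (t : ℝ) :
    ∃ w y : Fin Q.dim × Fin Q.dim → ℝ, (∀ k, 0 ≤ w k) ∧ ∑ k, w k = 1 ∧
      (∀ s, Real.exp (Q.renyi t s) = ∑ k, w k * Real.exp ((s - 1) * y k)) ∧
      expect Q.ω (Q.meanEntropyProduction t) = 1 / t * ∑ k, w k * y k := by
  obtain ⟨w, y, hw, hw1, hR, -, hlog⟩ := exists_modular_law (Q.posDef_state t) Q.posDef_ω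
    (Q.trace_state t)
  refine ⟨w, y, hw, hw1, hR, ?_⟩
  have e1 : Matrix.trace (Q.ω * Q.evolve Q.entropyObservable t) =
      -Matrix.trace (Q.state t * cfc Real.log Q.ω) := by
    rw [evolve, entropyObservable, state, ← Matrix.mul_assoc, ← Matrix.mul_assoc,
      Matrix.trace_mul_comm]
    simp only [Matrix.mul_assoc, Matrix.mul_neg, Matrix.trace_neg]
  have e2 : Matrix.trace (Q.ω * Q.entropyObservable) =
      -Matrix.trace (cfc (fun x => x * Real.log x) (Q.state t)) := by
    rw [entropyObservable, Matrix.mul_neg, Matrix.trace_neg, cfc_state,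
      Matrix.trace_mul_comm (_ * _), ← Matrix.mul_assoc, propagator_mul_neg, Matrix.one_mul,
      ← cfc_mul_cfc Q.ω (fun x => x) Real.log, cfc_id' ℝ Q.ω Q.posDef_ω.1.isSelfAdjoint]
  rw [← hlog, expect, meanEntropyProduction, Matrix.mul_smul, Matrix.trace_smul, smul_eq_mul,
    Complex.re_ofReal_mul, Matrix.mul_sub, Matrix.trace_sub, e1, e2]
  simp only [Complex.sub_re, Complex.neg_re]
  ring

end FiniteQuantumSystem

variable {Q : ℕ → FiniteQuantumSystem} {I : Set ℝ} {eT : ℝ → ℝ → ℝ} {e : ℝ → ℝ}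

theorem FiniteQuantumSystem.renyi_zero (Q : FiniteQuantumSystem) (t : ℝ) : Q.renyi t 0 = 0 := by
  rw [renyi, renyiEntropy_symm, sub_zero,
    renyiEntropy_one Q.posDef_ω (Q.posDef_state t) Q.trace_ω]

namespace AssumptionLT

theorem rate_zero (h : AssumptionLT Q I eT e) : e 0 = 0 := by
  have h0 : (0 : ℝ) ∈ I := h.subset (by simp)
  have hE : ∀ t : ℝ, 0 < t → eT t 0 = 0 := fun t ht => by
    have := h.tendsto_renyi t ht 0 h0
    simp only [FiniteQuantumSystem.renyi_zero] at this
    exact tendsto_nhds_unique this tendsto_const_nhds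
  refine tendsto_nhds_unique (h.tendsto_rate 0 h0) (tendsto_const_nhds.congr' ?_)
  filter_upwards [eventually_gt_atTop 0] with t ht
  rw [hE t ht, mul_zero]

/-- The two states are separated by the time `2t`, so `e_{2t}` supplies the rate. Since `e 0 = 0`
and `e'(0) < 0`, some `e u` with `0 < u < 1` is negative, which gives the growth of the dimension.
-/
theorem isRegularPair (h : AssumptionLT Q I eT e) (h0 : deriv e 0 < 0) :
    IsRegularPair (forward Q) (backward Q) e where
  posDef_left m t := (Q m).posDef_state t
  posDef_right m t := (Q m).posDef_state (-t)
  trace_left m t := (Q m).trace_state t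
  trace_right m t := (Q m).trace_state (-t)
  dim := by
    obtain ⟨u, hu, hu1, -, hfu, -⟩ := exists_symmetric_slope
      (h.differentiable 0 (h.subset (by simp)))
      (eventually_lt_nhds zero_lt_one) (show 0 < -deriv e 0 / 2 by linarith)
    rw [h.rate_zero, zero_add, zero_add] at hfu
    rw [zero_add] at hu1
    have hs : u ∈ Set.Icc (0 : ℝ) 1 := ⟨hu.le, hu1.le⟩
    exact tendsto_dim_atTop hs (fun t ht => h.tendsto_renyi t ht u (h.subset hs))
      (h.tendsto_rate u (h.subset hs)) (by nlinarith)
  rate s hs := by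
    filter_upwards [h.isOpen.mem_nhds (h.subset hs)] with v hv η hη
    have h2 : Tendsto (fun t : ℝ => 2 * t) atTop atTop := tendsto_id.const_mul_atTop two_pos
    filter_upwards [h2.eventually (Metric.tendsto_nhds.1 (h.tendsto_rate v hv) (η / 2)
      (half_pos hη)), eventually_gt_atTop 0] with t ht ht0
    filter_upwards [Metric.tendsto_nhds.1 (h.tendsto_renyi (2 * t) (by positivity) v hv)
      (2 * t * (η / 2)) (by positivity)] with m hm
    have e1 : renyiEntropy (forward Q m t) (backward Q m t) v = (Q m).renyi (2 * t) v := by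
      rw [forward, backward, (Q m).renyiEntropy_state]
      congr 1
      ring
    rw [e1]
    rw [Real.dist_eq] at hm ht
    have e2 : eT (2 * t) v - 2 * t * e v = 2 * t * (1 / (2 * t) * eT (2 * t) v - e v) := by
      field_simp
    have e3 : |eT (2 * t) v - 2 * t * e v| ≤ 2 * t * (η / 2) := by
      rw [e2, abs_mul, abs_of_pos (show 0 < 2 * t by positivity)]
      exact mul_le_mul_of_nonneg_left ht.le (by positivity)
    have e4 := abs_sub_le ((Q m).renyi (2 * t) v) (eT (2 * t) v) (2 * t * e v)
    linarith
  differentiable s hs := h.differentiable s (h.subset hs)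

/-- The moment generating functions converge for exponents near `0`. Their difference quotients
approximate the mean with an error that is linear in the increment and uniform in large `m`, so the
means converge as well. -/
theorem exists_tendsto_meanEntropyProduction (h : AssumptionTD Q I eT) {t : ℝ} (ht : 0 < t) :
    ∃ a, Tendsto (fun m => expect (Q m).ω ((Q m).meanEntropyProduction t)) atTop (𝓝 a) := by
  choose w y hw hw1 hR hS using fun m => (Q m).exists_entropyProduction_law t
  have h1 : (1 : ℝ) ∈ I := h.subset (by simp)
  obtain ⟨ε, hε, hI⟩ := Metric.mem_nhds_iff.1 (h.isOpen.mem_nhds h1)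
  set δ := ε / 2 with hδ
  have hδ0 : 0 < δ := by positivity
  have hmem : ∀ x, |x| ≤ δ → 1 + x ∈ I := fun x hx => hI (by
    rw [Metric.mem_ball, Real.dist_eq, add_sub_cancel_left]; linarith)
  have hM : ∀ x, |x| ≤ δ → Tendsto (fun m => ∑ k, w m k * Real.exp (x * y m k)) atTop
      (𝓝 (Real.exp (eT t (1 + x)))) := fun x hx => by
    have := (Real.continuous_exp.tendsto _).comp (h.tendsto_renyi t ht _ (hmem x hx))
    refine this.congr fun m => ?_
    simp only [Function.comp, hR, add_sub_cancel_left]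
  obtain ⟨a, ha⟩ := exists_tendsto_of_quotient (A := fun m => ∑ k, w m k * y m k)
    (B := fun m => 8 / δ ^ 2 * (∑ k, w m k * Real.exp (δ * y m k) +
      ∑ k, w m k * Real.exp (-δ * y m k)))
    (q := fun x m => (∑ k, w m k * Real.exp (x * y m k) - 1) / x) (half_pos hδ0)
    (((hM δ (abs_of_pos hδ0).le).add
      (hM (-δ) (by rw [abs_neg]; exact (abs_of_pos hδ0).le))).const_mul _)
    (fun x hx hxδ => ⟨_, ((hM x (by rw [abs_of_pos hx]; linarith)).sub_const 1).div_const x⟩)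
    (fun x hx hxδ m => by
      have key := abs_sum_exp_sub_le (y := y m) (hw m) (hw1 m) hδ0
        (show |x| ≤ δ / 2 by rwa [abs_of_pos hx])
      have e1 : (∑ k, w m k * Real.exp (x * y m k) - 1) / x - ∑ k, w m k * y m k =
          (∑ k, w m k * Real.exp (x * y m k) - 1 - x * ∑ k, w m k * y m k) / x := by
        field_simp
      rw [e1, abs_div, abs_of_pos hx, div_le_iff₀ hx]
      refine key.trans (le_of_eq ?_)
      ring)
  exact ⟨1 / t * a, (ha.const_mul _).congr fun m => (hS m).symm⟩

theorem isEntropyProductionRate (h : AssumptionLT Q I eT e) (h0 : deriv e 0 < 0) :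
    IsEntropyProductionRate Q (deriv e 1) := by
  classical
  have hex : ∀ t : ℝ, ∃ a, 0 < t →
      Tendsto (fun m => expect (Q m).ω ((Q m).meanEntropyProduction t)) atTop (𝓝 a) := fun t => by
    by_cases ht : 0 < t
    · obtain ⟨a, ha⟩ := exists_tendsto_meanEntropyProduction h.toAssumptionTD ht
      exact ⟨a, fun _ => ha⟩
    · exact ⟨0, fun h => absurd h ht⟩
  choose S hS using hex
  refine ⟨S, hS, ?_⟩
  -- Jensen's inequality, in the limit `m → ∞`. Taking `x = ±u` bounds `S t` on both sides by
  -- difference quotients of `e_t / t` at `1`, which tend to those of `e`.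
  have hle : ∀ t : ℝ, 0 < t → ∀ x, 1 + x ∈ I → x * S t ≤ 1 / t * eT t (1 + x) := by
    intro t ht x hx
    refine le_of_tendsto_of_tendsto' ((hS t ht).const_mul x)
      ((h.tendsto_renyi t ht _ hx).const_mul (1 / t)) fun m => ?_
    obtain ⟨w, y, hw, hw1, hR, hE⟩ := (Q m).exists_entropyProduction_law t
    have h1 := exp_mul_sum_le (y := y) hw hw1 x
    have h2 := hR (1 + x)
    rw [add_sub_cancel_left] at h2
    rw [← h2, Real.exp_le_exp] at h1
    rw [hE, mul_left_comm]
    exact mul_le_mul_of_nonneg_left h1 (by positivity)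
  have hI1 : (1 : ℝ) ∈ I := h.subset (by simp)
  refine Metric.tendsto_nhds.2 fun δ hδ => ?_
  obtain ⟨u, hu, hu1, hu2, hf1, hf2⟩ := exists_symmetric_slope (h.differentiable 1 hI1)
    (h.isOpen.mem_nhds hI1) (show 0 < δ / 4 by positivity)
  rw [(h.isRegularPair h0).apply_one] at hf1 hf2
  have hη : 0 < u * (δ / 4) := by positivity
  filter_upwards [eventually_gt_atTop 0, Metric.tendsto_nhds.1 (h.tendsto_rate _ hu1) _ hη,
    Metric.tendsto_nhds.1 (h.tendsto_rate _ hu2) _ hη] with t ht ht1 ht2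
  have a1 := hle t ht u hu1
  have a2 := hle t ht (-u) (by rwa [← sub_eq_add_neg])
  rw [← sub_eq_add_neg] at a2
  have b1 := (abs_lt.1 (Real.dist_eq _ _ ▸ ht1)).2
  have b2 := (abs_lt.1 (Real.dist_eq _ _ ▸ ht2)).2
  rw [Real.dist_eq]
  have c1 : u * (S t - deriv e 1) ≤ u * (δ / 2) := by linarith
  have c2 : u * (deriv e 1 - S t) ≤ u * (δ / 2) := by linarith
  have d1 := le_of_mul_le_mul_left c1 hu
  have d2 := le_of_mul_le_mul_left c2 hu
  rw [abs_lt]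
  constructor <;> linarith

end AssumptionLT

end

end ArrowOfTime

theorem mainTheorem7 (Q : ℕ → ArrowOfTime.FiniteQuantumSystem) (I : Set ℝ)
    (eT : ℝ → ℝ → ℝ) (e : ℝ → ℝ)
    (hLT : ArrowOfTime.AssumptionLT Q I eT e)
    (h0 : deriv e 0 < 0) (h1 : 0 < deriv e 1) :
    -- Chernoff exponents
    (ArrowOfTime.chernoffLower (ArrowOfTime.forward Q) (ArrowOfTime.backward Q)
        = ⨅ s ∈ Set.Icc (0 : ℝ) 1, (e s : EReal) ∧
      ArrowOfTime.chernoffUpper (ArrowOfTime.forward Q) (ArrowOfTime.backward Q)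
        = ⨅ s ∈ Set.Icc (0 : ℝ) 1, (e s : EReal)) ∧
    -- Hoeffding exponents of the pair `(ω_{mt}, ω_{m(-t)})`
    (∀ r : ℝ,
      ArrowOfTime.hoeffdingLower (ArrowOfTime.forward Q) (ArrowOfTime.backward Q) r
        = ArrowOfTime.hoeffdingFunction e r ∧
      ArrowOfTime.hoeffdingUpper (ArrowOfTime.forward Q) (ArrowOfTime.backward Q) r
        = ArrowOfTime.hoeffdingFunction e r ∧
      ArrowOfTime.hoeffding (ArrowOfTime.forward Q) (ArrowOfTime.backward Q) r
        = ArrowOfTime.hoeffdingFunction e r) ∧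
    -- Stein exponents of the pair `(ω_{mt}, ω_{m(-t)})`
    (∃ σ : ℝ, ArrowOfTime.IsEntropyProductionRate Q σ ∧ σ = deriv e 1 ∧
      ∀ ε : ℝ, 0 < ε → ε < 1 →
        ArrowOfTime.steinLower (ArrowOfTime.forward Q) (ArrowOfTime.backward Q) ε
          = ((-σ : ℝ) : EReal) ∧
        ArrowOfTime.steinUpper (ArrowOfTime.forward Q) (ArrowOfTime.backward Q) ε
          = ((-σ : ℝ) : EReal) ∧
        ArrowOfTime.stein (ArrowOfTime.forward Q) (ArrowOfTime.backward Q) ε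
          = ((-σ : ℝ) : EReal)) ∧
    -- The same with the roles of the two hypotheses exchanged: `e(s)` becomes `e(1 - s)`
    (∀ r : ℝ,
      ArrowOfTime.hoeffdingLower (ArrowOfTime.backward Q) (ArrowOfTime.forward Q) r
        = ArrowOfTime.hoeffdingFunction (fun s => e (1 - s)) r ∧
      ArrowOfTime.hoeffdingUpper (ArrowOfTime.backward Q) (ArrowOfTime.forward Q) r
        = ArrowOfTime.hoeffdingFunction (fun s => e (1 - s)) r ∧
      ArrowOfTime.hoeffding (ArrowOfTime.backward Q) (ArrowOfTime.forward Q) r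
        = ArrowOfTime.hoeffdingFunction (fun s => e (1 - s)) r) ∧
    (∀ ε : ℝ, 0 < ε → ε < 1 →
      ArrowOfTime.steinLower (ArrowOfTime.backward Q) (ArrowOfTime.forward Q) ε
        = ((deriv e 0 : ℝ) : EReal) ∧
      ArrowOfTime.steinUpper (ArrowOfTime.backward Q) (ArrowOfTime.forward Q) ε
        = ((deriv e 0 : ℝ) : EReal) ∧
      ArrowOfTime.stein (ArrowOfTime.backward Q) (ArrowOfTime.forward Q) ε
        = ((deriv e 0 : ℝ) : EReal)) := by
  have h := hLT.isRegularPair h0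
  -- Exchanging the hypotheses reflects the rate function about `1/2`, so the slope at `1` becomes
  -- `-e'(0)`. No time reversal invariance enters.
  have hd : deriv (fun s => e (1 - s)) 1 = -deriv e 0 := by
    rw [deriv_comp_const_sub, sub_self]
  refine ⟨h.chernoff h0 h1, h.hoeffding, ⟨deriv e 1, hLT.isEntropyProductionRate h0, rfl,
    fun ε hε hε1 => h.stein hε hε1⟩, h.swap.hoeffding, fun ε hε hε1 => ?_⟩
  have hs := h.swap.stein hε hε1
  rwa [hd, neg_neg] at hs
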